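/- For $0<q<1$ let $\mathrm{TDGD}(q)$ be the distribution $P(i,j)=(1-q)^2q^{i+j}$ on pairs of integers $i,j\ge 0$; call $i+j$ the signature of $(i,j)$, so that $s+1$ pairs have signature $s$. A binary prefix code for the pairs is optimal for $\mathrm{TDGD}(q)$ if its average code length is minimal among all binary prefix codes for the pairs. Let $k>1$ be an integer and $q=2^{-k}$. Write $U_m$ for the uniform binary tree of depth $m$ ($2^m$ leaves, of weight $1$), $[X,Y]$ for a node with the two children $X$ and $Y$, and $q^sT$ for the tree $T$ with all signatures raised by $s$ (a leaf of weight $q^s$ has signature $s$; a leaf of $T$ of weight $1$ has signature $0$). Let $L_k$ be the infinite tree obtained from $U_k$ by attaching a copy of $qL_k$ to its leftmost leaf, and $L_k^-$ the tree obtained from $U_{k-1}$ by attaching a copy of $qL_k$ to its leftmost leaf. The infinite tree $C_{-k}$ is described by layers $\mathcal L_s$, $s\ge 0$. Layer $\mathcal L_s$ consists of the nodes of two consecutive levels, contains the leaves of signature $s$, and is listed below from left to right by its nodes in the upper level, up to the factor $q^s$. There $1$ is a leaf of signature $s$, a symbol followed by $\times n$ is repeated $n$ times, $R_s$ is the root of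 the subtree that contains all signatures greater than $s$ not contained in other symbols of the layer, and $M$ is the sequence $qL_k,\ 1\times(2^k-1)$. If $0\le s\le 2^{k-1}-2$, write $s=2^i+j-1$ with $0\le j\le 2^i-1$; the layer is $1\times(2^i-j-1),\ [R_s,1],\ [1,1]\times j$. If $s\ge 2^{k-1}-1$, write $s=2^{k-1}-1+(2^k-1)\ell+j$ with $\ell\ge 0$, $0\le j<2^k-1$; the layer consists of $M\times\ell$ followed by (i) $1\times(2^{k-1}-j-1),\ [R_s,1],\ [1,1]\times j$, if $0\le j\le 2^{k-1}-3$; (ii) $[qU_{k-1},R_s],\ [1,1]\times(2^{k-1}-1)$, if $j=2^{k-1}-2$; (iii) $1\times(3\cdot2^{k-1}-2-j),\ [qU_{k-1},R_s],\ [1,1]\times(j-2^{k-1}+1)$, if $2^{k-1}-1\le j\le 2^k-4$; (iv) $1\times(2^{k-1}+1),\ [qL_k^-,R_s],\ [1,1]\times(2^{k-1}-2)$, if $j=2^k-3$; (v) $qL_k,\ 1\times(2^{k-1}-1),\ [R_s,1],\ [1,1]\times(2^{k-1}-1)$, if $j=2^k-2$. Layer $\mathcal L_{s+1}$ arises from $\mathcal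 L_s$ by unfolding the copies of $U_{k-1}$, $L_k$, $L_k^-$ according to their definitions and letting $R_s$ be the root of a uniform tree (of depth $i$ if $s+1=2^i+j-1\le 2^{k-1}-2$ as above, and of depth $k-1$ if $s+1\ge 2^{k-1}-1$) whose leaves are replaced by the remaining nodes of the list of $\mathcal L_{s+1}$, in order, where a node $1$ remains a leaf; the upper level of $\mathcal L_0=[R_0,1]$ is the root of $C_{-k}$. Theorem. For every integer $k>1$ this construction is consistent (unfolding layer by layer does produce the layers listed above) and $C_{-k}$ is a full binary tree with exactly $s+1$ leaves of signature $s$ for every $s\ge 0$. Every code that maps, for each $s$, the pairs of signature $s$ bijectively to the leaves of $C_{-k}$ of signature $s$ has finite average code length under $\mathrm{TDGD}(q)$ and is an optimal prefix code for $\mathrm{TDGD}(q)$, $q=2^{-k}$. -/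

import Mathlib

/-! ## Prefix codes for pairs of nonnegative integers -/

namespace TDGD

/-- The two-dimensional geometric distribution: `P (i, j) = (1 - q)^2 q^(i + j)`. -/
noncomputable def prob (q : ℝ) (a : ℕ × ℕ) : ℝ := (1 - q) ^ 2 * q ^ (a.1 + a.2)

/-- A binary prefix code for the alphabet of pairs: no codeword is a prefix of the codeword of
another symbol (in particular the code is injective). -/
def IsPrefixCode (c : ℕ × ℕ → List Bool) : Prop :=
  ∀ a b, a ≠ b → ¬ c a <+: c b

/-- The tree of the code is full: every node that is not a leaf (a proper prefix of a codeword)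
has both children in the tree. -/
def IsFull (c : ℕ × ℕ → List Bool) : Prop :=
  ∀ (w : List Bool) (a : ℕ × ℕ), w <+: c a → w ≠ c a → ∀ b : Bool, ∃ a', w ++ [b] <+: c a'

/-- The average code length of `c` under the distribution `prob q`, as an extended nonnegative
number (so that no summability is presupposed). -/
noncomputable def avgLength (q : ℝ) (c : ℕ × ℕ → List Bool) : ENNReal :=
  ∑' a : ℕ × ℕ, ENNReal.ofReal (prob q a) * ((c a).length : ENNReal)

/-- `c` is an optimal prefix code for the two-dimensional geometric distribution. -/
def IsOptimal (q : ℝ) (c : ℕ × ℕ → List Bool) : Prop :=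
  IsPrefixCode c ∧ ∀ c' : ℕ × ℕ → List Bool, IsPrefixCode c' → avgLength q c ≤ avgLength q c'

/-! ## Finite full binary trees with labelled leaves -/

/-- Finite full binary trees with labelled leaves. -/
inductive BTree (α : Type) : Type
  | leaf (a : α) : BTree α
  | node (l r : BTree α) : BTree α

namespace BTree

/-- Replace every leaf labelled `a` by the tree `f a`. -/
def bind {α β : Type} : BTree α → (α → BTree β) → BTree β
  | leaf a, f => f a
  | node l r, f => node (l.bind f) (r.bind f)

/-- The leaves from left to right, each with the binary word that leads to it from the root
(`false` for a left branch, `true` for a right branch) and its label. -/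
def leaves {α : Type} : BTree α → List (List Bool × α)
  | leaf a => [([], a)]
  | node l r =>
      l.leaves.map (fun p => (false :: p.1, p.2)) ++ r.leaves.map (fun p => (true :: p.1, p.2))

/-- The subtrees rooted at the nodes of depth `d`, from left to right. -/
def level {α : Type} : ℕ → BTree α → List (BTree α)
  | 0, t => [t]
  | _ + 1, leaf _ => []
  | d + 1, node l r => level d l ++ level d r

/-- The uniform tree of depth `h`, with the `2 ^ h` trees of the list `l` attached to its leaves
from left to right (only used for lists of length `2 ^ h`). -/
def uniform {α : Type} [Inhabited α] : ℕ → List (BTree α) → BTree α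
  | 0, l => l.headD (leaf default)
  | h + 1, l => node (uniform h (l.take (2 ^ h))) (uniform h (l.drop (2 ^ h)))

theorem level_uniform {α : Type} [Inhabited α] (h : ℕ) (l : List (BTree α))
    (hl : l.length = 2 ^ h) : level h (uniform h l) = l := by
  induction h generalizing l with
  | zero =>
    obtain ⟨a, rfl⟩ := List.length_eq_one_iff.mp (by simpa using hl)
    rfl
  | succ h ih =>
    have h2 : 2 ^ (h + 1) = 2 ^ h + 2 ^ h := by ring
    rw [uniform, level, ih _ (by rw [List.length_take]; omega),
      ih _ (by rw [List.length_drop]; omega), List.take_append_drop]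

end BTree

open BTree

/-! ## The layered code with parameter `k` (for `q = 2 ^ (-k)`) -/

/-- The symbols from which the layers are built. -/
inductive Sym : Type
  /-- a final leaf of the code, of signature `s` -/
  | sig (s : ℕ) : Sym
  /-- `q^s U_m`: the uniform tree of depth `m`, all of whose leaves have signature `s` -/
  | unif (m s : ℕ) : Sym
  /-- `q^s L_k` -/
  | selfSim (s : ℕ) : Sym
  /-- `q^s L_k⁻` -/
  | selfSimMinus (s : ℕ) : Sym
  /-- the virtual symbol `R_s`: everything of signature greater than `s` that is not in another
  virtual symbol -/
  | rest (s : ℕ) : Sym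

instance : Inhabited Sym := ⟨.sig 0⟩

/-- A leaf of signature `s`, drawn as a boxed `1` in layer `s`. -/
def one (s : ℕ) : BTree Sym := leaf (.sig s)

/-- Two sibling leaves of signature `s`. -/
def pair (s : ℕ) : BTree Sym := node (one s) (one s)

/-- The node `R_s`. -/
def root (s : ℕ) : BTree Sym := leaf (.rest s)

/-- In the first case (`s + 2 ≤ 2^(k-1)`) write `s = 2^i + j - 1` with `0 ≤ j ≤ 2^i - 1`;
this is `i`. -/
def idx (s : ℕ) : ℕ := Nat.log 2 (s + 1)

/-- In the first case write `s = 2^i + j - 1` with `0 ≤ j ≤ 2^i - 1`; this is `j`. -/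
def off (s : ℕ) : ℕ := s + 1 - 2 ^ idx s

/-- In the second case (`2^(k-1) ≤ s + 1`) write `s = 2^(k-1) - 1 + (2^k - 1) ℓ + j` with
`0 ≤ j < 2^k - 1`; this is `ℓ`. -/
def cycle (k s : ℕ) : ℕ := (s + 1 - 2 ^ (k - 1)) / (2 ^ k - 1)

/-- In the second case write `s = 2^(k-1) - 1 + (2^k - 1) ℓ + j` with `0 ≤ j < 2^k - 1`;
this is `j`. -/
def pos (k s : ℕ) : ℕ := (s + 1 - 2 ^ (k - 1)) % (2 ^ k - 1)

/-- The sequence `M` in layer `s`: the symbol `q L_k` followed by `2^k - 1` leaves of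
signature `s`. -/
def macroM (k s : ℕ) : List (BTree Sym) :=
  leaf (.selfSim (s + 1)) :: List.replicate (2 ^ k - 1) (one s)

/-- Layer `s` of the code, listed from left to right: the nodes of its upper level, where a pair
of siblings in its lower level is listed as a tree with two leaves. -/
def layer (k s : ℕ) : List (BTree Sym) :=
  if s + 2 ≤ 2 ^ (k - 1) then
    List.replicate (2 ^ idx s - off s - 1) (one s) ++ [node (root s) (one s)] ++
      List.replicate (off s) (pair s)
  else
    (List.replicate (cycle k s) (macroM k s)).flatten ++
    if pos k s + 3 ≤ 2 ^ (k - 1) then -- type (i)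
      List.replicate (2 ^ (k - 1) - pos k s - 1) (one s) ++ [node (root s) (one s)] ++
        List.replicate (pos k s) (pair s)
    else if pos k s + 2 = 2 ^ (k - 1) then -- type (ii)
      [node (leaf (.unif (k - 1) (s + 1))) (root s)] ++
        List.replicate (2 ^ (k - 1) - 1) (pair s)
    else if pos k s + 4 ≤ 2 ^ k then -- type (iii)
      List.replicate (3 * 2 ^ (k - 1) - 2 - pos k s) (one s) ++
        [node (leaf (.unif (k - 1) (s + 1))) (root s)] ++
        List.replicate (pos k s + 1 - 2 ^ (k - 1)) (pair s)
    else if pos k s + 3 = 2 ^ k then -- type (iv)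
      List.replicate (2 ^ (k - 1) + 1) (one s) ++
        [node (leaf (.selfSimMinus (s + 1))) (root s)] ++
        List.replicate (2 ^ (k - 1) - 2) (pair s)
    else -- type (v)
      [leaf (.selfSim (s + 1))] ++ List.replicate (2 ^ (k - 1) - 1) (one s) ++
        [node (root s) (one s)] ++ List.replicate (2 ^ (k - 1) - 1) (pair s)

/-- The tree into which `R_(s-1)` unfolds (for `s = 0`: the top of the code); its leaves are
symbols of layer `s`. It is the quasi-uniform tree with `s + 2` leaves in the first case and the
quasi-uniform tree with `2^(k-1) + j + 1` leaves in type (i), one of the deepest leaves being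
`R_s`; in the other types it is a uniform tree of depth `k - 1`, some of whose leaves are split.
The remaining symbols of layer `s` come from the other virtual symbols of layer `s - 1`. -/
def rootTree (k s : ℕ) : BTree Sym :=
  if s + 2 ≤ 2 ^ (k - 1) then
    uniform (idx s) (List.replicate (2 ^ idx s - off s - 1) (one s) ++
      [node (root s) (one s)] ++ List.replicate (off s) (pair s))
  else if pos k s + 3 ≤ 2 ^ (k - 1) then -- type (i)
    uniform (k - 1) (List.replicate (2 ^ (k - 1) - pos k s - 1) (one s) ++
      [node (root s) (one s)] ++ List.replicate (pos k s) (pair s))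
  else if pos k s + 2 = 2 ^ (k - 1) then -- type (ii)
    uniform (k - 1) ([node (leaf (.unif (k - 1) (s + 1))) (root s)] ++
      List.replicate (2 ^ (k - 1) - 1) (pair s))
  else if pos k s + 4 ≤ 2 ^ k then -- type (iii)
    uniform (k - 1) (List.replicate (2 ^ k - 2 - pos k s) (one s) ++
      [node (leaf (.unif (k - 1) (s + 1))) (root s)] ++
      List.replicate (pos k s + 1 - 2 ^ (k - 1)) (pair s))
  else if pos k s + 3 = 2 ^ k then -- type (iv)
    uniform (k - 1) ([one s] ++ [node (leaf (.selfSimMinus (s + 1))) (root s)] ++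
      List.replicate (2 ^ (k - 1) - 2) (pair s))
  else -- type (v)
    uniform (k - 1) ([node (root s) (one s)] ++ List.replicate (2 ^ (k - 1) - 1) (pair s))

/-- How a symbol unfolds. The tree `L_k` is `U_k` with a copy of `q L_k` attached to its leftmost
leaf, and `L_k⁻` is `U_(k-1)` with a copy of `q L_k` attached to its leftmost leaf. -/
def unfold (k : ℕ) : Sym → BTree Sym
  | .sig s => leaf (.sig s)
  | .unif m s => uniform m (List.replicate (2 ^ m) (one s))
  | .selfSim s =>
      uniform k (leaf (.selfSim (s + 1)) :: List.replicate (2 ^ k - 1) (one s))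
  | .selfSimMinus s =>
      uniform (k - 1) (leaf (.selfSim (s + 1)) :: List.replicate (2 ^ (k - 1) - 1) (one s))
  | .rest s => rootTree k (s + 1)

/-- The top part of the code, down to layer `s`. -/
def stage (k : ℕ) : ℕ → BTree Sym
  | 0 => rootTree k 0
  | s + 1 => (stage k s).bind (unfold k)

/-- The words that lead from the root of the infinite tree to its leaves of signature `s`.
(Leaves of `stage k t` labelled by a signature stay leaves in all later stages.) -/
def codewords (k s : ℕ) : Set (List Bool) :=
  {w | ∃ t, (w, Sym.sig s) ∈ (stage k t).leaves}

/-- `c` is the code of the infinite tree: for every `s`, the symbols `(i, j)` with `i + j = s` are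
mapped bijectively, in some order, to the leaves of signature `s`. -/
def IsLayeredCode (k : ℕ) (c : ℕ × ℕ → List Bool) : Prop :=
  ∀ s, Set.BijOn c {a | a.1 + a.2 = s} (codewords k s)

end TDGD

/-! Optimality is proved by Huffman's algorithm on finite truncations, followed by a limit. In the
truncation `stage k s` every virtual symbol of layer s counts as one letter, whose weight `wt` is
the total weight of its subtree, up to the factor (1 - q)^2. The weight W of L_k solves W = 2^k - 1
+ qW, so W = 2^k. Hence q^(s+1) L_k weighs q^s, exactly as much as a leaf of signature s; the
symbols made from U_(k-1) and L_k⁻ weigh half of that, and R_s takes the rest of the tail. By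
`wt_rest_bounds`, R_s weighs at most q^s, and together with its sibling it weighs between q^s and
2q^s. The upper level of each layer is therefore sorted, with weights in [q^s, 2q^s]
(`layer_weights`).

This is the situation in which Huffman's algorithm builds uniform trees: in a sorted list with ratio
at most 2, neighbours are merged in order, and the sums are again sorted with ratio at most 2. Read
from the bottom up, the siblings in the lower level of layer s + 1 are merged first, then its upper
level collapses round by round into the virtual symbols of layer s (`CostBound.of_virt`). Induction
gives the optimality of every truncation, `costBound_stage`. The single step `CostBound.merge` is
stated for arbitrary lengths that satisfy Kraft's inequality, so competing codes need no tree.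

The combinatorial side rests on `layer_shape`, a normal form common to all types of layers, and on
`layer_succ`, by which the virtual symbols of one layer unfold in order into the next. They yield
the consistency of the layers (`exists_level_stage`) and the leaf count (`labels_stage`).

For the limit, a competing prefix code lends the codewords of some pairs of signature s + 1 to the
virtual symbols of layer s. The error in `treeCost_stage_le` is at most q^s times the sum of all
codeword lengths of signature s + 1, which is 2^k times one term of the competitor's cost series,
grouped by signature. It tends to 0 whenever the competitor has finite average length
(`IsLayeredCode.avgLength_le`). Comparison with a unary code then gives finiteness. -/

namespace TDGD

/-! ## Kraft's inequality for prefix-free sets of words -/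

/-- A prefix-free set of nonempty words is uniquely decodable. -/
theorem uniquelyDecodable_of_prefixFree {S : Set (List Bool)} (h0 : [] ∉ S)
    (hS : ∀ u ∈ S, ∀ v ∈ S, u <+: v → u = v) :
    InformationTheory.UniquelyDecodable S := by
  intro L₁
  induction L₁ with
  | nil =>
    intro L₂ _ h2 he
    cases L₂ with
    | nil => rfl
    | cons v L₂ =>
      have hv : v = [] := by
        simp only [List.flatten_nil, List.flatten_cons] at he
        exact (List.append_eq_nil_iff.mp he.symm).1
      exact absurd (hv ▸ h2 v (by simp)) h0
  | cons u L₁ ih =>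
    intro L₂ h1 h2 he
    cases L₂ with
    | nil =>
      have hu : u = [] := by
        simp only [List.flatten_nil, List.flatten_cons] at he
        exact (List.append_eq_nil_iff.mp he).1
      exact absurd (hu ▸ h1 u (by simp)) h0
    | cons v L₂ =>
      simp only [List.flatten_cons] at he
      have huv : u = v := by
        rcases List.prefix_or_prefix_of_prefix (l₃ := u ++ L₁.flatten) (List.prefix_append _ _)
          (he ▸ List.prefix_append v L₂.flatten) with h | h
        · exact hS u (h1 u (by simp)) v (h2 v (by simp)) h
        · exact (hS v (h2 v (by simp)) u (h1 u (by simp)) h).symm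
      subst huv
      rw [List.append_cancel_left_eq] at he
      rw [ih L₂ (fun w hw => h1 w (by simp [hw])) (fun w hw => h2 w (by simp [hw])) he]

/-- Kraft's inequality for a finite set of source symbols under a prefix code. -/
theorem IsPrefixCode.kraft {c : ℕ × ℕ → List Bool} (hc : IsPrefixCode c) (S : Finset (ℕ × ℕ)) :
    ∑ a ∈ S, (1 / 2 : ℝ) ^ (c a).length ≤ 1 := by
  have hinj : Function.Injective c := fun a b hab => by
    by_contra hne
    exact hc a b hne (hab ▸ List.prefix_rfl)
  -- The empty word is a prefix of every word, so it could only encode a one-letter alphabet.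
  have h0 : ∀ a, c a ≠ [] := fun a ha => by
    obtain ⟨b, hb⟩ := exists_ne a
    exact hc a b hb.symm (ha ▸ List.nil_prefix)
  have hud : InformationTheory.UniquelyDecodable (↑(S.image c) : Set (List Bool)) := by
    apply uniquelyDecodable_of_prefixFree
    · simp [h0]
    · intro u hu v hv huv
      simp only [Finset.coe_image, Set.mem_image] at hu hv
      obtain ⟨a, _, rfl⟩ := hu
      obtain ⟨b, _, rfl⟩ := hv
      by_contra hne
      exact hc a b (fun h => hne (by rw [h])) huv
  have := InformationTheory.kraft_mcmillan_inequality hud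
  rw [Finset.sum_image (fun a _ b _ hab => hinj hab)] at this
  simpa using this

/-! ## Lower bounds for the cost of length assignments, by Huffman's merging step -/

/-- The Kraft sum of a multiset of codeword lengths. -/
noncomputable def kraftSum (L : Multiset ℕ) : ℝ := (L.map fun l => (1 / 2 : ℝ) ^ l).sum

/-- The cost of a multiset of pairs (weight, codeword length). -/
noncomputable def cost (P : Multiset (ℝ × ℕ)) : ℝ := (P.map fun p => p.1 * (p.2 : ℝ)).sum

/-- Every assignment of lengths to the weights `W` that satisfies Kraft's inequality costs at
least `c`. -/
def CostBound (W : Multiset ℝ) (c : ℝ) : Prop :=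
  ∀ P : Multiset (ℝ × ℕ), P.map Prod.fst = W → kraftSum (P.map Prod.snd) ≤ 1 → c ≤ cost P

/-- The longest length may be moved to a smallest weight without raising the cost. -/
theorem exists_longest_first (a : ℝ) (l : ℕ) (P : Multiset (ℝ × ℕ))
    (ha : ∀ p ∈ P, a ≤ p.1) :
    ∃ (l' : ℕ) (P' : Multiset (ℝ × ℕ)), P'.map Prod.fst = P.map Prod.fst ∧
      l' ::ₘ P'.map Prod.snd = l ::ₘ P.map Prod.snd ∧
      cost ((a, l') ::ₘ P') ≤ cost ((a, l) ::ₘ P) ∧ ∀ p ∈ P', p.2 ≤ l' := by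
  classical
  by_cases h : ∀ p ∈ P, p.2 ≤ l
  · exact ⟨l, P, rfl, rfl, le_rfl, h⟩
  push Not at h
  obtain ⟨p₀, hp₀, hl₀⟩ := h
  obtain ⟨m, hm, hmax⟩ := P.toFinset.exists_max_image Prod.snd ⟨p₀, by simpa using hp₀⟩
  simp only [Multiset.mem_toFinset] at hm hmax
  obtain ⟨Q, rfl⟩ := Multiset.exists_cons_of_mem hm
  have hlm : l < m.2 := lt_of_lt_of_le hl₀ (hmax p₀ hp₀)
  refine ⟨m.2, (m.1, l) ::ₘ Q, by simp, by simp [Multiset.cons_swap], ?_, ?_⟩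
  -- Rearrangement: the exchange lowers the cost by (m.1 - a)(m.2 - l), which is nonnegative.
  · have h1 : a ≤ m.1 := ha m hm
    have h2 : (l : ℝ) ≤ m.2 := by exact_mod_cast hlm.le
    simp only [cost, Multiset.map_cons, Multiset.sum_cons]
    nlinarith
  · intro p hp
    rcases Multiset.mem_cons.mp hp with rfl | hp
    · exact hlm.le
    · exact hmax p (Multiset.mem_cons_of_mem hp)

/-- Each 2^(-l) with l ≤ n is a multiple of 2^(-n). This integrality lets a strict Kraft inequality
be sharpened by a full unit 2^(-n) in `CostBound.merge`. -/
theorem exists_nat_kraftSum (n : ℕ) (L : Multiset ℕ) (hL : ∀ l ∈ L, l ≤ n) :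
    ∃ m : ℕ, kraftSum L * 2 ^ n = m := by
  induction L using Multiset.induction_on with
  | empty => exact ⟨0, by simp [kraftSum]⟩
  | cons l L ih =>
    obtain ⟨m, hm⟩ := ih fun i hi => hL i (Multiset.mem_cons_of_mem hi)
    refine ⟨2 ^ (n - l) + m, ?_⟩
    have hl : l ≤ n := hL l (Multiset.mem_cons_self l L)
    have h2 : (1 / 2 : ℝ) ^ l * 2 ^ n = 2 ^ (n - l) := by
      obtain ⟨d, rfl⟩ := Nat.exists_eq_add_of_le hl
      rw [pow_add, ← mul_assoc, ← mul_pow]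
      simp
    rw [kraftSum] at hm
    rw [kraftSum, Multiset.map_cons, Multiset.sum_cons, add_mul, h2, hm]
    push_cast
    rfl

/-- Huffman's step: two smallest weights may be merged. -/
theorem CostBound.merge {a b c : ℝ} {W : Multiset ℝ} (ha : 0 ≤ a) (hab : a ≤ b)
    (hW : ∀ w ∈ W, b ≤ w) (h : CostBound ((a + b) ::ₘ W) c) :
    CostBound (a ::ₘ b ::ₘ W) (c + (a + b)) := by
  classical
  intro P hP hK
  obtain ⟨⟨a', la⟩, hpa, rfl, hPb⟩ := (Multiset.map_eq_cons _ _ _ _).mpr hP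
  obtain ⟨P, rfl⟩ := Multiset.exists_cons_of_mem hpa
  clear hP
  rw [Multiset.erase_cons_head] at hPb
  obtain ⟨⟨b', lb⟩, hpb, rfl, hP⟩ := (Multiset.map_eq_cons _ _ _ _).mpr hPb
  obtain ⟨P, rfl⟩ := Multiset.exists_cons_of_mem hpb
  clear hPb
  rw [Multiset.erase_cons_head] at hP
  simp only at *
  have hb : ∀ p ∈ P, b' ≤ p.1 := fun p hp => hW _ (hP ▸ Multiset.mem_map_of_mem _ hp)
  obtain ⟨la, P₁, h1w, h1l, h1c, h1m⟩ := exists_longest_first a' la ((b', lb) ::ₘ P) (by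
    intro p hp
    rcases Multiset.mem_cons.mp hp with rfl | hp
    · exact hab
    · exact hab.trans (hb p hp))
  rw [Multiset.map_cons] at h1w
  obtain ⟨⟨b'', lb₁⟩, hpb₁, hbb, h1w'⟩ := (Multiset.map_eq_cons _ _ _ _).mpr h1w
  obtain ⟨P₁, rfl⟩ := Multiset.exists_cons_of_mem hpb₁
  rw [Multiset.erase_cons_head] at h1w'
  clear h1w
  simp only at hbb
  subst hbb
  obtain ⟨lb', P₂, h2w, h2l, h2c, h2m⟩ := exists_longest_first b'' lb₁ P₁ (by
    intro p hp
    exact hW _ (hP ▸ h1w' ▸ Multiset.mem_map_of_mem _ hp))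
  have hlba : lb' ≤ la := by
    have : lb' ∈ lb₁ ::ₘ P₁.map Prod.snd := h2l ▸ Multiset.mem_cons_self _ _
    rw [← Multiset.map_cons Prod.snd (b'', lb₁) P₁] at this
    obtain ⟨p, hp, hpl⟩ := Multiset.mem_map.mp this
    exact hpl ▸ h1m p hp
  have hK2 : (1 / 2 : ℝ) ^ la + ((1 / 2 : ℝ) ^ lb' + kraftSum (P₂.map Prod.snd)) ≤ 1 := by
    have : kraftSum (la ::ₘ lb' ::ₘ P₂.map Prod.snd) ≤ 1 := by
      rw [h2l]
      simp only [Multiset.map_cons] at h1l hK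
      rwa [h1l]
    simpa [kraftSum] using this
  -- All remaining lengths are at most `lb'` ≤ `la`. Scaled by 2^`lb'`, every term of the Kraft sum
  -- except that of `la` is an integer. As the term of `la` is positive, there is room to shorten
  -- `la` to `lb'`, which makes the two smallest weights siblings.
  obtain ⟨m, hm⟩ := exists_nat_kraftSum lb' (P₂.map Prod.snd) (by simpa using fun l a h => h2m _ h)
  have hm1 : 1 + (1 + (m : ℝ)) ≤ 2 ^ lb' := by
    have hpos : (0 : ℝ) < 2 ^ lb' := by positivity
    have hlt : (1 : ℝ) + m < 2 ^ lb' := by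
      have h3 := mul_le_mul_of_nonneg_right hK2 hpos.le
      have h4 : (1 / 2 : ℝ) ^ lb' * 2 ^ lb' = 1 := by rw [← mul_pow]; norm_num
      have h5 : (0 : ℝ) < (1 / 2 : ℝ) ^ la * 2 ^ lb' := by positivity
      rw [add_mul, add_mul, h4, hm] at h3
      linarith
    have : 1 + m < 2 ^ lb' := by exact_mod_cast hlt
    have : 1 + (1 + m) ≤ 2 ^ lb' := by omega
    exact_mod_cast this
  obtain ⟨n, rfl⟩ : ∃ n, lb' = n + 1 := by
    cases lb' with
    | zero =>
      have : (0 : ℝ) ≤ m := by positivity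
      norm_num at hm1
      linarith
    | succ n => exact ⟨n, rfl⟩
  -- The parent of the two siblings has length `lb'` - 1 = `n`; the lost level accounts for the
  -- additional cost a + b.
  have hfin := h ((a' + b'', n) ::ₘ P₂) (by simp [h2w, h1w', hP]) (by
    have hpos : (0 : ℝ) < 2 ^ (n + 1) := by positivity
    rw [Multiset.map_cons, kraftSum, Multiset.map_cons, Multiset.sum_cons, ← kraftSum]
    rw [← mul_le_mul_iff_of_pos_right hpos, add_mul, hm]
    have : (1 / 2 : ℝ) ^ n * 2 ^ (n + 1) = 2 := by
      rw [pow_succ, ← mul_assoc, ← mul_pow]; norm_num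
    linarith)
  have hla : ((n + 1 : ℕ) : ℝ) ≤ la := by exact_mod_cast hlba
  simp only [cost, Multiset.map_cons, Multiset.sum_cons] at hfin h1c h2c ⊢
  push_cast at *
  nlinarith

/-! ## Merging adjacent weights in a sorted list -/

/-- Merge adjacent entries of a list of weights. -/
def mergePairs : List ℝ → List ℝ
  | a :: b :: l => (a + b) :: mergePairs l
  | l => l

theorem length_mergePairs (n : ℕ) : ∀ l : List ℝ, l.length = n * 2 → (mergePairs l).length = n := by
  induction n with
  | zero => intro l hl; simp_all [mergePairs]
  | succ n ih =>
    rintro (_ | ⟨a, _ | ⟨b, l⟩⟩) hl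
    · simp at hl
    · simp at hl; omega
    · simp only [List.length_cons] at hl
      simp [mergePairs, ih l (by omega)]

theorem mergePairs_append (n : ℕ) :
    ∀ l l' : List ℝ, l.length = n * 2 → mergePairs (l ++ l') = mergePairs l ++ mergePairs l' := by
  induction n with
  | zero => intro l l' hl; simp_all [mergePairs]
  | succ n ih =>
    rintro (_ | ⟨a, _ | ⟨b, l⟩⟩) l' hl
    · simp at hl
    · simp at hl; omega
    · simp only [List.length_cons] at hl
      simp [mergePairs, ih l l' (by omega)]

theorem sum_mergePairs (n : ℕ) : ∀ l : List ℝ, l.length = n * 2 → (mergePairs l).sum = l.sum := by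
  induction n with
  | zero => intro l hl; simp_all [mergePairs]
  | succ n ih =>
    rintro (_ | ⟨a, _ | ⟨b, l⟩⟩) hl
    · simp at hl
    · simp at hl; omega
    · simp only [List.length_cons] at hl
      simp [mergePairs, ih l (by omega), add_assoc]

theorem mergePairs_replicate (n : ℕ) (x : ℝ) :
    mergePairs (List.replicate (n * 2) x) = List.replicate n (2 * x) := by
  induction n with
  | zero => rfl
  | succ n ih =>
    rw [show (n + 1) * 2 = n * 2 + 1 + 1 by ring]
    simp [List.replicate_succ, mergePairs, ih, two_mul]

theorem mem_mergePairs {x y : ℝ} (n : ℕ) :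
    ∀ l : List ℝ, l.length = n * 2 → (∀ w ∈ l, x ≤ w ∧ w ≤ y) →
      ∀ w ∈ mergePairs l, 2 * x ≤ w ∧ w ≤ 2 * y := by
  induction n with
  | zero => intro l hl; simp_all [mergePairs]
  | succ n ih =>
    rintro (_ | ⟨a, _ | ⟨b, l⟩⟩) hl h
    · simp at hl
    · simp at hl; omega
    · simp only [List.length_cons] at hl
      simp only [List.mem_cons, forall_eq_or_imp, mergePairs] at h ⊢
      obtain ⟨⟨h1, h2⟩, ⟨h3, h4⟩, h5⟩ := h
      exact ⟨⟨by linarith, by linarith⟩, ih l (by omega) h5⟩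

theorem sorted_mergePairs (n : ℕ) :
    ∀ l : List ℝ, l.length = n * 2 → l.Pairwise (· ≤ ·) → (mergePairs l).Pairwise (· ≤ ·) := by
  induction n with
  | zero => intro l hl; simp_all [mergePairs]
  | succ n ih =>
    rintro (_ | ⟨a, _ | ⟨b, l⟩⟩) hl h
    · simp at hl
    · simp at hl; omega
    · simp only [List.length_cons] at hl
      simp only [List.pairwise_cons, List.mem_cons, forall_eq_or_imp, mergePairs] at h ⊢
      obtain ⟨⟨h1, h2⟩, h3, h4⟩ := h
      refine ⟨?_, ih l (by omega) h4⟩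
      -- Only the lower bound matters; the maximum serves as some upper bound for `mem_mergePairs`.
      have hl' : ∀ y, y ∈ l → b ≤ y ∧ y ≤ l.foldr max b := fun y hy =>
        ⟨h3 y hy, by
          clear * - hy
          induction l with
          | nil => simp at hy
          | cons z l ih =>
            rcases List.mem_cons.mp hy with rfl | hy
            · exact le_max_left _ _
            · exact (ih hy).trans (le_max_right _ _)⟩
      intro w hw
      have := (mem_mergePairs n l (by omega) hl' w hw).1
      linarith

/-- The threshold `u` separates weights not yet merged from sums already formed. While `l` is
nonempty, its first two entries are smallest overall, so Huffman's algorithm consumes `l` in order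
and never touches a new sum before `l` is exhausted. -/
theorem CostBound.of_mergePairs {u c : ℝ} (n : ℕ) :
    ∀ (l : List ℝ) (W : Multiset ℝ), l.length = n * 2 → l.Pairwise (· ≤ ·) →
      (∀ w ∈ l, 0 ≤ w ∧ w ≤ u) → (∀ w ∈ mergePairs l, u ≤ w) → (∀ w ∈ W, u ≤ w) →
      CostBound ((mergePairs l : Multiset ℝ) + W) c → CostBound ((l : Multiset ℝ) + W) (c + l.sum) := by
  induction n with
  | zero => intro l W hl; simp_all [mergePairs]
  | succ n ih =>
    rintro (_ | ⟨a, _ | ⟨b, l⟩⟩) W hl hs hu hm hW h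
    · simp at hl
    · simp at hl; omega
    · simp only [List.length_cons] at hl
      simp only [List.pairwise_cons, List.mem_cons, forall_eq_or_imp, mergePairs] at hs hu hm
      obtain ⟨⟨h1, h2⟩, h3, h4⟩ := hs
      have key := ih l ((a + b) ::ₘ W) (by omega) h4 hu.2.2 hm.2 (by
        intro w hw
        rcases Multiset.mem_cons.mp hw with rfl | hw
        · exact hm.1
        · exact hW w hw) (by
        simpa [mergePairs, ← Multiset.cons_coe] using h)
      rw [Multiset.add_cons] at key
      have := CostBound.merge hu.1.1 h1 (W := (l : Multiset ℝ) + W) (by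
        intro w hw
        rcases Multiset.mem_add.mp hw with hw | hw
        · exact h3 w (by simpa using hw)
        · exact hu.2.1.2.trans (hW w hw)) key
      have e : c + (a :: b :: l).sum = c + l.sum + (a + b) := by simp; ring
      rw [e]
      simpa [← Multiset.cons_coe] using this

theorem length_mergePairs_iterate (h m : ℕ) :
    ∀ l : List ℝ, l.length = m * 2 ^ h → (mergePairs^[h] l).length = m := by
  induction h with
  | zero => intro l hl; simpa using hl
  | succ h ih =>
    intro l hl
    rw [Function.iterate_succ_apply]
    exact ih _ (length_mergePairs _ _ (by rw [hl]; ring))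

theorem mergePairs_iterate_append (h m : ℕ) :
    ∀ l l' : List ℝ, l.length = m * 2 ^ h →
      mergePairs^[h] (l ++ l') = mergePairs^[h] l ++ mergePairs^[h] l' := by
  induction h with
  | zero => intro l l' _; rfl
  | succ h ih =>
    intro l l' hl
    have hl' : l.length = (m * 2 ^ h) * 2 := by rw [hl]; ring
    simp only [Function.iterate_succ_apply]
    rw [mergePairs_append _ _ _ hl', ih _ _ (length_mergePairs _ _ hl')]

theorem sum_mergePairs_iterate (h m : ℕ) :
    ∀ l : List ℝ, l.length = m * 2 ^ h → (mergePairs^[h] l).sum = l.sum := by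
  induction h with
  | zero => intro l _; rfl
  | succ h ih =>
    intro l hl
    have hl' : l.length = (m * 2 ^ h) * 2 := by rw [hl]; ring
    rw [Function.iterate_succ_apply, ih _ (length_mergePairs _ _ hl'), sum_mergePairs _ _ hl']

theorem mergePairs_iterate_eq_singleton (h : ℕ) (l : List ℝ) (hl : l.length = 2 ^ h) :
    mergePairs^[h] l = [l.sum] := by
  have hl' : l.length = 1 * 2 ^ h := by simpa using hl
  obtain ⟨a, ha⟩ := List.length_eq_one_iff.mp (length_mergePairs_iterate h 1 l hl')
  rw [← sum_mergePairs_iterate h 1 l hl', ha]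
  simp

theorem mergePairs_iterate_replicate (h n : ℕ) (x : ℝ) :
    mergePairs^[h] (List.replicate (n * 2 ^ h) x) = List.replicate n (2 ^ h * x) := by
  induction h generalizing x with
  | zero => simp
  | succ h ih =>
    rw [Function.iterate_succ_apply, show n * 2 ^ (h + 1) = n * 2 ^ h * 2 by ring,
      mergePairs_replicate, ih]
    congr 1
    ring

theorem mem_mergePairs_iterate {y : ℝ} (h m : ℕ) :
    ∀ (l : List ℝ) (x : ℝ), l.length = m * 2 ^ h → (∀ w ∈ l, x ≤ w ∧ w ≤ y) →
      ∀ w ∈ mergePairs^[h] l, 2 ^ h * x ≤ w := by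
  induction h generalizing y with
  | zero => intro l x _ h w hw; simpa using (h w hw).1
  | succ h ih =>
    intro l x hl hb
    have hl' : l.length = (m * 2 ^ h) * 2 := by rw [hl]; ring
    rw [Function.iterate_succ_apply]
    intro w hw
    have := ih _ (2 * x) (length_mergePairs _ _ hl') (mem_mergePairs _ _ hl' hb) w hw
    rw [pow_succ, mul_assoc]
    exact this

/-- A sorted list of weights that differ at most by a factor `2` may be merged into uniform trees
of depth `h` if all other weights are large. -/
theorem CostBound.of_mergePairs_iterate {c : ℝ} (h m : ℕ) :
    ∀ (l : List ℝ) (x : ℝ) (W : Multiset ℝ), 0 ≤ x → l.length = m * 2 ^ h → l.Pairwise (· ≤ ·) →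
      (∀ w ∈ l, x ≤ w ∧ w ≤ 2 * x) → (∀ w ∈ W, 2 ^ h * x ≤ w) →
      CostBound ((mergePairs^[h] l : List ℝ) + W) c →
      CostBound ((l : Multiset ℝ) + W) (c + h * l.sum) := by
  induction h with
  | zero => intro l x W _ _ _ _ _ h; simpa using h
  | succ h ih =>
    intro l x W hx hl hs hb hW hc
    have hl' : l.length = (m * 2 ^ h) * 2 := by rw [hl]; ring
    have hm := mem_mergePairs _ _ hl' hb
    have h1 := ih (mergePairs l) (2 * x) W (by linarith) (length_mergePairs _ _ hl')
      (sorted_mergePairs _ _ hl' hs) hm (by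
        intro w hw
        have := hW w hw
        rw [pow_succ, mul_assoc] at this
        exact this) hc
    have hp : (1 : ℝ) ≤ 2 ^ h := one_le_pow₀ (by norm_num)
    have h2 := CostBound.of_mergePairs _ l W hl' hs (u := 2 * x)
      (fun w hw => ⟨hx.trans (hb w hw).1, (hb w hw).2⟩) (fun w hw => (hm w hw).1) (fun w hw => by
        have := hW w hw
        rw [pow_succ] at this
        nlinarith) h1
    rw [sum_mergePairs _ _ hl'] at h2
    have e : c + (h + 1 : ℕ) * l.sum = c + h * l.sum + l.sum := by push_cast; ring
    rw [e]
    exact h2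

/-- As `CostBound.of_mergePairs_iterate`, with an initial segment of constant weights that are
merged into uniform trees of depth `h + 1`. -/
theorem CostBound.of_prefix {c x : ℝ} {W : Multiset ℝ} (h m n : ℕ) (l : List ℝ) (hx : 0 ≤ x)
    (hl : l.length = m * 2 ^ h) (hs : l.Pairwise (· ≤ ·)) (hb : ∀ w ∈ l, x ≤ w ∧ w ≤ 2 * x)
    (hW : ∀ w ∈ W, 2 ^ h * x ≤ w)
    (hc : CostBound (Multiset.replicate n (2 ^ (h + 1) * x) + (mergePairs^[h] l : List ℝ) + W) c) :
    CostBound (Multiset.replicate (n * 2 ^ (h + 1)) x + (l : Multiset ℝ) + W)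
      (c + n * ((h + 1) * (2 ^ (h + 1) * x)) + h * l.sum) := by
  have hp : (1 : ℝ) ≤ 2 ^ h := one_le_pow₀ (by norm_num)
  have hn : n * 2 ^ (h + 1) = (n * 2) * 2 ^ h := by ring
  have hit : mergePairs^[h] (List.replicate (n * 2 ^ (h + 1)) x ++ l)
      = List.replicate (n * 2) (2 ^ h * x) ++ mergePairs^[h] l := by
    rw [hn, mergePairs_iterate_append _ (n * 2) _ _ (by simp), mergePairs_iterate_replicate]
  -- The last round: after h common rounds the constant part consists of copies of 2^h x, and every
  -- other weight is at least that, so the copies are paired once more.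
  have h1 := CostBound.of_mergePairs (u := 2 ^ h * x) (c := c) n
    (List.replicate (n * 2) (2 ^ h * x)) ((mergePairs^[h] l : List ℝ) + W) (by simp)
    (by simp [List.pairwise_replicate]) (by
      intro w hw
      rw [List.eq_of_mem_replicate hw]
      exact ⟨by positivity, le_rfl⟩) (by
      intro w hw
      rw [mergePairs_replicate] at hw
      rw [List.eq_of_mem_replicate hw]
      nlinarith) (by
      intro w hw
      rcases Multiset.mem_add.mp hw with hw | hw
      · exact mem_mergePairs_iterate h m l x hl hb w (by simpa using hw)
      · exact hW w hw) (by
      rw [mergePairs_replicate, Multiset.coe_replicate, ← add_assoc, ← mul_assoc, mul_comm (2 : ℝ),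
        ← pow_succ]
      exact hc)
  have h2 := CostBound.of_mergePairs_iterate (c := c + (List.replicate (n * 2) (2 ^ h * x)).sum)
    h (n * 2 + m) (List.replicate (n * 2 ^ (h + 1)) x ++ l) x W hx
    (by rw [List.length_append, hl, List.length_replicate]; ring) (by
      rw [List.pairwise_append]
      refine ⟨by simp [List.pairwise_replicate], hs, ?_⟩
      intro a ha b hb'
      rw [List.eq_of_mem_replicate ha]
      exact (hb b hb').1) (by
      intro w hw
      rcases List.mem_append.mp hw with hw | hw
      · rw [List.eq_of_mem_replicate hw]
        constructor <;> linarith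
      · exact hb w hw) hW (by
      rw [hit, ← Multiset.coe_add, add_assoc]
      exact h1)
  rw [← Multiset.coe_add, Multiset.coe_replicate] at h2
  convert h2 using 1
  simp
  ring

/-! ### Weights, costs, levels and leaves of labelled trees -/

namespace BTree

variable {α β : Type}

/-- The labels of the leaves from left to right. -/
def labels : BTree α → List α
  | leaf a => [a]
  | node l r => l.labels ++ r.labels

theorem map_snd_leaves (T : BTree α) : T.leaves.map Prod.snd = T.labels := by
  induction T with
  | leaf a => rfl
  | node l r ihl ihr => simp [leaves, labels, ← ihl, ← ihr, Function.comp_def]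

theorem labels_bind (T : BTree α) (f : α → BTree β) :
    (T.bind f).labels = T.labels.flatMap fun a => (f a).labels := by
  induction T with
  | leaf a => simp [bind, labels]
  | node l r ihl ihr => simp [bind, labels, ihl, ihr]

theorem leaves_bind (T : BTree α) (f : α → BTree β) :
    (T.bind f).leaves = T.leaves.flatMap fun p => (f p.2).leaves.map fun p' => (p.1 ++ p'.1, p'.2) := by
  induction T with
  | leaf a => simp [bind, leaves]
  | node l r ihl ihr =>
    simp [bind, leaves, ihl, ihr, List.map_flatMap, List.flatMap_map, Function.comp_def]

/-- The total weight of the leaves. -/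
noncomputable def weight (w : α → ℝ) (T : BTree α) : ℝ := (T.labels.map w).sum

/-- The sum over the leaves of weight times depth. -/
noncomputable def treeCost (w : α → ℝ) (T : BTree α) : ℝ :=
  (T.leaves.map fun p => w p.2 * (p.1.length : ℝ)).sum

@[simp] theorem weight_leaf (w : α → ℝ) (a : α) : weight w (leaf a) = w a := by
  simp [weight, labels]

@[simp] theorem weight_node (w : α → ℝ) (l r : BTree α) :
    weight w (node l r) = weight w l + weight w r := by
  simp [weight, labels]

@[simp] theorem treeCost_leaf (w : α → ℝ) (a : α) : treeCost w (leaf a) = 0 := by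
  simp [treeCost, leaves]

-- A new root pushes every leaf one level down, so the cost grows by the total weight. This is the
-- amount charged by one Huffman merge.
@[simp] theorem treeCost_node (w : α → ℝ) (l r : BTree α) :
    treeCost w (node l r) = treeCost w l + treeCost w r + weight w (node l r) := by
  have h : ∀ (b : Bool) (T : BTree α), ((T.leaves.map fun p => (b :: p.1, p.2)).map
      fun p => w p.2 * (p.1.length : ℝ)).sum = treeCost w T + weight w T := by
    intro b T
    rw [weight, ← map_snd_leaves, treeCost, List.map_map, List.map_map, ← List.sum_map_add]
    congr 1
    apply List.map_congr_left
    intro p _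
    simp
    ring
  rw [treeCost, leaves, List.map_append, List.sum_append, h, h, weight_node]
  ring

theorem weight_bind (w : β → ℝ) (w' : α → ℝ) (f : α → BTree β) (T : BTree α)
    (h : ∀ a ∈ T.labels, weight w (f a) = w' a) : weight w (T.bind f) = weight w' T := by
  induction T with
  | leaf a => simpa [bind, labels] using h
  | node l r ihl ihr =>
    simp only [labels, List.mem_append] at h
    simp [bind, ihl fun a ha => h a (.inl ha), ihr fun a ha => h a (.inr ha)]

/-- When substitution preserves weights, the path to a substituted tree costs what the path to the
old leaf did; only the costs inside the substituted trees are new. -/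
theorem treeCost_bind (w : α → ℝ) (f : α → BTree α) (T : BTree α)
    (h : ∀ a ∈ T.labels, weight w (f a) = w a) :
    treeCost w (T.bind f) = treeCost w T + (T.labels.map fun a => treeCost w (f a)).sum := by
  induction T with
  | leaf a => simp [bind, labels]
  | node l r ihl ihr =>
    have hb := weight_bind w w f (node l r) h
    simp only [labels, List.mem_append] at h
    rw [bind] at hb ⊢
    rw [treeCost_node, hb, ihl fun a ha => h a (.inl ha), ihr fun a ha => h a (.inr ha),
      treeCost_node, labels]
    simp
    ring

theorem sum_map_weight (w : α → ℝ) (l : List (BTree α)) :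
    ((l.flatMap labels).map w).sum = (l.map (weight w)).sum := by
  induction l with
  | nil => rfl
  | cons t l ih => simp [ih, weight]

section uniform

variable [Inhabited α]

theorem length_take_drop {l : List β} {h : ℕ} (hl : l.length = 2 ^ (h + 1)) :
    (l.take (2 ^ h)).length = 2 ^ h ∧ (l.drop (2 ^ h)).length = 2 ^ h := by
  rw [pow_succ] at hl
  constructor <;> simp <;> omega

theorem labels_uniform (h : ℕ) (l : List (BTree α)) (hl : l.length = 2 ^ h) :
    (uniform h l).labels = l.flatMap labels := by
  induction h generalizing l with
  | zero =>
    obtain ⟨a, rfl⟩ := List.length_eq_one_iff.mp (by simpa using hl)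
    simp [uniform]
  | succ h ih =>
    obtain ⟨h1, h2⟩ := length_take_drop hl
    rw [uniform, labels, ih _ h1, ih _ h2, ← List.flatMap_append, List.take_append_drop]

theorem weight_uniform (w : α → ℝ) (h : ℕ) (l : List (BTree α)) (hl : l.length = 2 ^ h) :
    weight w (uniform h l) = (l.map (weight w)).sum := by
  rw [weight, labels_uniform h l hl, sum_map_weight]

theorem treeCost_uniform (w : α → ℝ) (h : ℕ) (l : List (BTree α)) (hl : l.length = 2 ^ h) :
    treeCost w (uniform h l) = h * (l.map (weight w)).sum + (l.map (treeCost w)).sum := by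
  induction h generalizing l with
  | zero =>
    obtain ⟨a, rfl⟩ := List.length_eq_one_iff.mp (by simpa using hl)
    simp [uniform]
  | succ h ih =>
    obtain ⟨h1, h2⟩ := length_take_drop hl
    have e : ∀ g : BTree α → ℝ, (l.map g).sum
        = ((l.take (2 ^ h)).map g).sum + ((l.drop (2 ^ h)).map g).sum := fun g => by
      rw [← List.sum_append, ← List.map_append, List.take_append_drop]
    rw [uniform, treeCost_node, ih _ h1, ih _ h2, weight_node, weight_uniform _ _ _ h1,
      weight_uniform _ _ _ h2, e, e]
    push_cast
    ring

end uniform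

/-- All leaves of depth less than `d` have a label with the property `p`. -/
def AllAbove (p : α → Prop) : ℕ → BTree α → Prop
  | 0, _ => True
  | _ + 1, leaf a => p a
  | d + 1, node l r => AllAbove p d l ∧ AllAbove p d r

theorem allAbove_uniform [Inhabited α] (p : α → Prop) (h : ℕ) (l : List (BTree α)) :
    AllAbove p h (uniform h l) := by
  induction h generalizing l with
  | zero => trivial
  | succ h ih => exact ⟨ih _, ih _⟩

/-- Levels of an unfolded tree, if the leaves above level `d` do not unfold. -/
theorem level_bind {p : α → Prop} {f : α → BTree α} (hp : ∀ a, p a → f a = leaf a) (e : ℕ)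
    (he : 0 < e) (d : ℕ) (T : BTree α) (hT : AllAbove p d T) :
    level (d + e) (T.bind f) = (level d T).flatMap fun t => level e (t.bind f) := by
  induction d generalizing T with
  | zero => simp [level]
  | succ d ih =>
    cases T with
    | leaf a =>
      obtain ⟨e, rfl⟩ : ∃ e', e = e' + 1 := ⟨e - 1, by omega⟩
      rw [bind, hp a hT]
      simp [level]
    | node l r =>
      rw [show d + 1 + e = (d + e) + 1 by ring, bind, level, ih l hT.1, ih r hT.2, level,
        List.flatMap_append]

/-- Propagates the hypothesis of `level_bind`, so that levels can be followed through repeated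
unfolding. -/
theorem allAbove_bind {p : α → Prop} {f : α → BTree α} (hp : ∀ a, p a → f a = leaf a) (e d : ℕ)
    (T : BTree α) (hT : AllAbove p d T) (hl : ∀ t ∈ level d T, AllAbove p e (t.bind f)) :
    AllAbove p (d + e) (T.bind f) := by
  induction d generalizing T with
  | zero => simpa [level] using hl
  | succ d ih =>
    rw [show d + 1 + e = (d + e) + 1 by ring]
    cases T with
    | leaf a =>
      rw [bind, hp a hT]
      exact hT
    | node l r =>
      simp only [level, List.mem_append] at hl
      exact ⟨ih l hT.1 fun t ht => hl t (.inl ht), ih r hT.2 fun t ht => hl t (.inr ht)⟩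

/-- The words of the leaves are prefix free. -/
theorem eq_of_prefix_of_mem_leaves (T : BTree α) {p p' : List Bool × α} (hp : p ∈ T.leaves)
    (hp' : p' ∈ T.leaves) (h : p.1 <+: p'.1) : p = p' := by
  induction T generalizing p p' with
  | leaf a => simp_all [leaves]
  | node l r ihl ihr =>
    simp only [leaves, List.mem_append, List.mem_map] at hp hp'
    rcases hp with ⟨a, ha, rfl⟩ | ⟨a, ha, rfl⟩ <;> rcases hp' with ⟨b, hb, rfl⟩ | ⟨b, hb, rfl⟩ <;>
      simp only [List.cons_prefix_cons, Bool.false_eq_true, Bool.true_eq_false, false_and,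
        true_and] at h
    · rw [ihl ha hb h]
    · rw [ihr ha hb h]

theorem nodup_leaves (T : BTree α) : T.leaves.Nodup := by
  induction T with
  | leaf a => simp [leaves]
  | node l r ihl ihr =>
    rw [leaves, List.nodup_append]
    refine ⟨ihl.map ?_, ihr.map ?_, ?_⟩
    · intro a b h; simpa [Prod.ext_iff] using h
    · intro a b h; simpa [Prod.ext_iff] using h
    · intro a ha b hb hab
      obtain ⟨p, _, rfl⟩ := List.mem_map.mp ha
      obtain ⟨p', _, rfl⟩ := List.mem_map.mp hb
      simp at hab

theorem exists_leaf (T : BTree α) : ∃ p, p ∈ T.leaves := by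
  induction T with
  | leaf a => exact ⟨([], a), by simp [leaves]⟩
  | node l r ihl _ =>
    obtain ⟨p, hp⟩ := ihl
    exact ⟨(false :: p.1, p.2), by simp [leaves, hp]⟩

/-- Both children of an inner node lie on paths to leaves. -/
theorem exists_leaf_extending (T : BTree α) {p : List Bool × α} (hp : p ∈ T.leaves)
    {w : List Bool} (hw : w <+: p.1) (hne : w ≠ p.1) (b : Bool) :
    ∃ p' ∈ T.leaves, w ++ [b] <+: p'.1 := by
  induction T generalizing p w with
  | leaf a =>
    simp only [leaves, List.mem_singleton] at hp
    subst hp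
    simp_all
  | node l r ihl ihr =>
    cases w with
    | nil =>
      obtain ⟨p₁, h₁⟩ := exists_leaf l
      obtain ⟨p₂, h₂⟩ := exists_leaf r
      cases b
      · exact ⟨(false :: p₁.1, p₁.2), by simp [leaves, h₁], by simp⟩
      · exact ⟨(true :: p₂.1, p₂.2), by simp [leaves, h₂], by simp⟩
    | cons x w =>
      simp only [leaves, List.mem_append, List.mem_map] at hp
      rcases hp with ⟨a, ha, rfl⟩ | ⟨a, ha, rfl⟩ <;>
        simp only [List.cons_prefix_cons, ne_eq, List.cons.injEq, not_and] at hw hne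
      · obtain ⟨p', h1, h2⟩ := ihl ha hw.2 (hne hw.1)
        exact ⟨(x :: p'.1, p'.2), by simp [leaves, h1, hw.1], by simpa using h2⟩
      · obtain ⟨p', h1, h2⟩ := ihr ha hw.2 (hne hw.1)
        exact ⟨(x :: p'.1, p'.2), by simp [leaves, h1, hw.1], by simpa using h2⟩

end BTree

open BTree

/-! ## The virtual symbols of a layer -/

/-- The symbol is not yet a leaf of the code. -/
def isVirt : Sym → Bool
  | .sig _ => false
  | _ => true

/-- The number of symbols `q L_k` in layer `s`. -/
def selfCount (k s : ℕ) : ℕ :=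
  if s + 2 ≤ 2 ^ (k - 1) then 0
  else if pos k s + 3 ≤ 2 ^ k then cycle k s
  else cycle k s + 1

/-- The symbol `q U_(k-1)` or `q L_k⁻` of layer `s`, if there is one. -/
def extra (k s : ℕ) : List Sym :=
  if s + 2 ≤ 2 ^ (k - 1) then []
  else if pos k s + 3 ≤ 2 ^ (k - 1) then []
  else if pos k s + 4 ≤ 2 ^ k then [.unif (k - 1) (s + 1)]
  else if pos k s + 3 = 2 ^ k then [.selfSimMinus (s + 1)]
  else []

/-- The virtual symbols of layer `s`, from left to right. -/
def virt (k s : ℕ) : List Sym :=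
  List.replicate (selfCount k s) (.selfSim (s + 1)) ++ extra k s ++ [.rest s]

/-- The depth of the uniform tree at the top of `rootTree k s`. -/
def rootDepth (k s : ℕ) : ℕ := if s + 2 ≤ 2 ^ (k - 1) then idx s else k - 1

/-- The trees attached to the uniform tree at the top of `rootTree k s`. -/
def rootList (k s : ℕ) : List (BTree Sym) :=
  if s + 2 ≤ 2 ^ (k - 1) then
    List.replicate (2 ^ idx s - off s - 1) (one s) ++ [node (root s) (one s)] ++
      List.replicate (off s) (pair s)
  else if pos k s + 3 ≤ 2 ^ (k - 1) then
    List.replicate (2 ^ (k - 1) - pos k s - 1) (one s) ++ [node (root s) (one s)] ++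
      List.replicate (pos k s) (pair s)
  else if pos k s + 2 = 2 ^ (k - 1) then
    [node (leaf (.unif (k - 1) (s + 1))) (root s)] ++ List.replicate (2 ^ (k - 1) - 1) (pair s)
  else if pos k s + 4 ≤ 2 ^ k then
    List.replicate (2 ^ k - 2 - pos k s) (one s) ++
      [node (leaf (.unif (k - 1) (s + 1))) (root s)] ++
      List.replicate (pos k s + 1 - 2 ^ (k - 1)) (pair s)
  else if pos k s + 3 = 2 ^ k then
    [one s] ++ [node (leaf (.selfSimMinus (s + 1))) (root s)] ++
      List.replicate (2 ^ (k - 1) - 2) (pair s)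
  else
    [node (root s) (one s)] ++ List.replicate (2 ^ (k - 1) - 1) (pair s)

theorem rootTree_eq (k s : ℕ) : rootTree k s = uniform (rootDepth k s) (rootList k s) := by
  unfold rootTree rootDepth rootList
  split_ifs <;> rfl

/-- The depth of the uniform tree at the top of the unfolding of a symbol. -/
def height (k : ℕ) : Sym → ℕ
  | .sig _ => 0
  | .unif m _ => m
  | .selfSim _ => k
  | .selfSimMinus _ => k - 1
  | .rest s => rootDepth k (s + 1)

/-- The trees attached to the uniform tree at the top of the unfolding of a symbol. -/
def sub (k : ℕ) : Sym → List (BTree Sym)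
  | .sig s => [one s]
  | .unif m s => List.replicate (2 ^ m) (one s)
  | .selfSim s => leaf (.selfSim (s + 1)) :: List.replicate (2 ^ k - 1) (one s)
  | .selfSimMinus s => leaf (.selfSim (s + 1)) :: List.replicate (2 ^ (k - 1) - 1) (one s)
  | .rest s => rootList k (s + 1)

theorem unfold_eq (k : ℕ) (v : Sym) : unfold k v = uniform (height k v) (sub k v) := by
  cases v with
  | rest s => exact rootTree_eq k (s + 1)
  | _ => rfl

/-! ### Arithmetic of positions, and passage from one layer to the next -/

theorem first_case (s : ℕ) : s + 1 = 2 ^ idx s + off s ∧ off s < 2 ^ idx s := by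
  have h1 : 2 ^ idx s ≤ s + 1 := Nat.pow_log_le_self 2 (by omega)
  have h2 : s + 1 < 2 ^ (idx s + 1) := Nat.lt_pow_succ_log_self (by omega) _
  rw [pow_succ] at h2
  unfold off
  omega

theorem two_pow_facts {k : ℕ} (hk : 1 < k) : 2 ^ k = 2 * 2 ^ (k - 1) ∧ 2 ≤ 2 ^ (k - 1) := by
  obtain ⟨m, rfl⟩ : ∃ m, k = m + 2 := ⟨k - 2, by omega⟩
  have : 1 ≤ 2 ^ m := Nat.one_le_two_pow
  simp only [show m + 2 - 1 = m + 1 by omega, pow_succ]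
  omega

theorem second_case {k : ℕ} (hk : 1 < k) {s : ℕ} (h : ¬ s + 2 ≤ 2 ^ (k - 1)) :
    s + 1 = 2 ^ (k - 1) + (2 ^ k - 1) * cycle k s + pos k s ∧ pos k s < 2 ^ k - 1 := by
  obtain ⟨h1, h2⟩ := two_pow_facts hk
  have h3 := Nat.div_add_mod (s + 1 - 2 ^ (k - 1)) (2 ^ k - 1)
  have h4 := Nat.mod_lt (s + 1 - 2 ^ (k - 1)) (show 0 < 2 ^ k - 1 by omega)
  unfold cycle pos
  omega

theorem cycle_pos_eq {k : ℕ} (hk : 1 < k) {s ℓ j : ℕ}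
    (h : s + 1 = 2 ^ (k - 1) + (2 ^ k - 1) * ℓ + j) (hj : j < 2 ^ k - 1) :
    cycle k s = ℓ ∧ pos k s = j := by
  obtain ⟨h1, h2⟩ := two_pow_facts hk
  have e : s + 1 - 2 ^ (k - 1) = j + (2 ^ k - 1) * ℓ := by omega
  unfold cycle pos
  rw [e, Nat.add_mul_div_left _ _ (by omega), Nat.add_mul_mod_self_left, Nat.div_eq_of_lt hj,
    Nat.mod_eq_of_lt hj]
  simp

theorem cycle_pos_succ {k : ℕ} (hk : 1 < k) {s : ℕ} (h : ¬ s + 2 ≤ 2 ^ (k - 1)) :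
    (pos k s + 2 < 2 ^ k ∧ pos k (s + 1) = pos k s + 1 ∧ cycle k (s + 1) = cycle k s) ∨
    (pos k s + 2 = 2 ^ k ∧ pos k (s + 1) = 0 ∧ cycle k (s + 1) = cycle k s + 1) := by
  obtain ⟨h1, h2⟩ := second_case hk h
  obtain ⟨h3, h4⟩ := two_pow_facts hk
  rcases (show pos k s + 2 < 2 ^ k ∨ pos k s + 2 = 2 ^ k by omega) with h5 | h5
  · obtain ⟨h6, h7⟩ := cycle_pos_eq hk (s := s + 1) (ℓ := cycle k s) (j := pos k s + 1)
      (by omega) (by omega)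
    exact .inl ⟨h5, h7, h6⟩
  · obtain ⟨h6, h7⟩ := cycle_pos_eq hk (s := s + 1) (ℓ := cycle k s + 1) (j := 0)
      (by rw [mul_add]; omega) (by omega)
    exact .inr ⟨h5, h7, h6⟩

theorem cycle_pos_start {k : ℕ} (hk : 1 < k) {s : ℕ} (h : s + 2 ≤ 2 ^ (k - 1))
    (h' : ¬ s + 1 + 2 ≤ 2 ^ (k - 1)) : pos k (s + 1) = 0 ∧ cycle k (s + 1) = 0 := by
  obtain ⟨h3, h4⟩ := two_pow_facts hk
  exact (cycle_pos_eq hk (s := s + 1) (ℓ := 0) (j := 0) (by omega) (by omega)).symm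

/-- Each symbol L_k of layer s becomes one sequence M of layer s + 1. The new L_k created in type
(v), the last position of a cycle, explains why the cycle number then rises by one. -/
theorem selfCount_eq_cycle {k : ℕ} (hk : 1 < k) {s : ℕ} (h' : ¬ s + 1 + 2 ≤ 2 ^ (k - 1)) :
    selfCount k s = cycle k (s + 1) := by
  unfold selfCount
  by_cases h : s + 2 ≤ 2 ^ (k - 1)
  · have := cycle_pos_start hk h h'
    simp [h, this]
  · have := cycle_pos_succ hk h
    split_ifs <;> omega

/-- Re-indexes the additional symbol of layer s by the position of layer s + 1, so that `layer_succ`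
can split on the type of the new layer alone. -/
theorem extra_eq {k : ℕ} (hk : 1 < k) {s : ℕ} (h' : ¬ s + 1 + 2 ≤ 2 ^ (k - 1)) :
    extra k s = if pos k (s + 1) + 2 ≤ 2 ^ (k - 1) then []
      else if pos k (s + 1) + 3 ≤ 2 ^ k then [.unif (k - 1) (s + 1)]
      else [.selfSimMinus (s + 1)] := by
  obtain ⟨h3, h4⟩ := two_pow_facts hk
  unfold extra
  by_cases h : s + 2 ≤ 2 ^ (k - 1)
  · have := cycle_pos_start hk h h'
    simp [h, this, h4]
  · have := cycle_pos_succ hk h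
    split_ifs <;> first | rfl | omega

/-- Layer `s + 1` consists of the unfolded virtual symbols of layer `s`, in order. -/
theorem layer_succ {k : ℕ} (hk : 1 < k) (s : ℕ) :
    layer k (s + 1) = (virt k s).flatMap (sub k) := by
  have hM : sub k (.selfSim (s + 1)) = macroM k (s + 1) := rfl
  have hR : sub k (.rest s) = rootList k (s + 1) := rfl
  have hv : (virt k s).flatMap (sub k) = (List.replicate (selfCount k s) (macroM k (s + 1))).flatten
      ++ (extra k s).flatMap (sub k) ++ rootList k (s + 1) := by
    simp [virt, hR, ← hM, List.flatMap]
  rw [hv]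
  obtain ⟨h3, h4⟩ := two_pow_facts hk
  by_cases h' : s + 1 + 2 ≤ 2 ^ (k - 1)
  · have h : s + 2 ≤ 2 ^ (k - 1) := by omega
    simp [layer, rootList, selfCount, extra, h', h]
  · have h5 := second_case hk h'
    rw [selfCount_eq_cycle hk h', extra_eq hk h', layer, rootList, if_neg h', if_neg h']
    conv_rhs => rw [List.append_assoc]
    congr 1
    by_cases c1 : pos k (s + 1) + 3 ≤ 2 ^ (k - 1)
    · simp only [if_pos c1, if_pos (show pos k (s + 1) + 2 ≤ 2 ^ (k - 1) by omega)]
      rfl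
    by_cases c2 : pos k (s + 1) + 2 = 2 ^ (k - 1)
    · simp only [if_neg c1, if_pos c2, if_pos c2.le]
      rfl
    have c2' : ¬ pos k (s + 1) + 2 ≤ 2 ^ (k - 1) := by omega
    by_cases c3 : pos k (s + 1) + 4 ≤ 2 ^ k
    -- With j the position of the new layer, the unfolded U_(k-1) contributes 2^(k-1) leaves in
    -- front of the 2^k - 2 - j leaves from R_s, which gives 3·2^(k-1) - 2 - j in total.
    · simp only [if_neg c1, if_neg c2, if_neg c2', if_pos c3,
        if_pos (show pos k (s + 1) + 3 ≤ 2 ^ k by omega), List.flatMap_cons, sub, List.flatMap_nil,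
        List.append_nil, ← List.append_assoc, ← List.replicate_add]
      congr 4
      omega
    by_cases c4 : pos k (s + 1) + 3 = 2 ^ k
    · simp only [if_neg c1, if_neg c2, if_neg c2', if_neg c3, if_pos c4, if_pos c4.le,
        List.flatMap_cons, sub, List.flatMap_nil, List.append_nil, ← List.append_assoc,
        show [one (s + 1)] = List.replicate 1 (one (s + 1)) from rfl, ← List.replicate_add]
    · simp only [if_neg c1, if_neg c2, if_neg c2', if_neg c3, if_neg c4,
        if_neg (show ¬ pos k (s + 1) + 3 ≤ 2 ^ k by omega)]
      simp [sub]

theorem length_rootList {k : ℕ} (hk : 1 < k) (s : ℕ) :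
    (rootList k s).length = 2 ^ rootDepth k s := by
  obtain ⟨h3, h4⟩ := two_pow_facts hk
  have h1 := first_case s
  unfold rootList rootDepth
  by_cases h : s + 2 ≤ 2 ^ (k - 1)
  · simp [h]; omega
  · have := second_case hk h
    simp only [if_neg h]
    split_ifs <;> simp <;> omega

theorem length_sub {k : ℕ} (hk : 1 < k) (v : Sym) : (sub k v).length = 2 ^ height k v := by
  have : 1 ≤ 2 ^ k := Nat.one_le_two_pow
  have : 1 ≤ 2 ^ (k - 1) := Nat.one_le_two_pow
  cases v with
  | rest s => exact length_rootList hk (s + 1)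
  | _ => simp [sub, height] <;> omega

theorem rootDepth_eq {k s : ℕ} (h : ¬ s + 2 ≤ 2 ^ (k - 1)) : rootDepth k (s + 1) = k - 1 := by
  rw [rootDepth, if_neg (by omega)]

theorem rootDepth_lt {k : ℕ} (hk : 1 < k) (s : ℕ) : rootDepth k s < k := by
  unfold rootDepth
  split_ifs with h
  · have h1 := first_case s
    have : idx s < k - 1 := (Nat.pow_lt_pow_iff_right (show 1 < 2 by norm_num)).mp
      (show 2 ^ idx s < 2 ^ (k - 1) by omega)
    omega
  · omega

theorem rootDepth_pos {k : ℕ} (hk : 1 < k) (s : ℕ) : 0 < rootDepth k (s + 1) := by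
  unfold rootDepth
  split_ifs with h
  · exact Nat.log_pos (by norm_num) (by omega)
  · omega

/-- The additional symbol is the sibling of R_s, so both must unfold by the same depth for their new
nodes to lie on one level. -/
theorem height_extra {k s : ℕ} {v : Sym} (hv : v ∈ extra k s) :
    height k v = rootDepth k (s + 1) ∧ rootDepth k (s + 1) = k - 1 := by
  by_cases h : s + 2 ≤ 2 ^ (k - 1)
  · simp [extra, h] at hv
  · refine ⟨?_, rootDepth_eq h⟩
    rw [rootDepth_eq h]
    unfold extra at hv
    split_ifs at hv <;> simp_all [height]

theorem rootDepth_of_selfCount {k s : ℕ} (hv : selfCount k s ≠ 0) :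
    rootDepth k (s + 1) = k - 1 := by
  apply rootDepth_eq
  intro h
  simp [selfCount, h] at hv

/-- A layer consists of single symbols, one node with a virtual child, and pairs. -/
theorem layer_shape {k : ℕ} (hk : 1 < k) (s : ℕ) :
    ∃ (pre : List Sym) (p r : Sym) (b : ℕ),
      layer k s = pre.map leaf ++ node (leaf p) (leaf r) :: List.replicate b (pair s) ∧
      pre.filter isVirt = List.replicate (selfCount k s) (.selfSim (s + 1)) ∧
      (∀ a ∈ pre, a = .sig s ∨ a = .selfSim (s + 1)) ∧
      ((p = .rest s ∧ r = .sig s ∧ extra k s = [] ∧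
          pre.length + 2 * b + 1 = s + 1 + selfCount k s) ∨
        (r = .rest s ∧ extra k s = [p] ∧ (p = .unif (k - 1) (s + 1) ∨ p = .selfSimMinus (s + 1)) ∧
          pre.length + 2 * b = s + 1 + selfCount k s)) := by
  obtain ⟨h3, h4⟩ := two_pow_facts hk
  have h1 := first_case s
  have hM : ∀ n, (List.replicate n (macroM k s)).flatten = (List.replicate n
      (Sym.selfSim (s + 1) :: List.replicate (2 ^ k - 1) (Sym.sig s))).flatten.map leaf := by
    intro n
    induction n with
    | zero => rfl
    | succ n ih =>
      rw [List.replicate_succ, List.replicate_succ, List.flatten_cons, List.flatten_cons, ih,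
        List.map_append]
      simp [macroM, one]
  have hf : ∀ m, (Sym.selfSim (s + 1) :: List.replicate m (Sym.sig s)).filter isVirt
      = [Sym.selfSim (s + 1)] := by
    intro m
    rw [List.filter_cons_of_pos rfl]
    simp [isVirt]
  have hMf : ∀ n, (List.replicate n (Sym.selfSim (s + 1) ::
      List.replicate (2 ^ k - 1) (Sym.sig s))).flatten.filter isVirt
        = List.replicate n (Sym.selfSim (s + 1)) := by
    intro n
    induction n with
    | zero => rfl
    | succ n ih =>
      rw [List.replicate_succ, List.flatten_cons, List.filter_append, ih, hf]
      rfl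
  have hMl : ∀ n, (List.replicate n (Sym.selfSim (s + 1) ::
      List.replicate (2 ^ k - 1) (Sym.sig s))).flatten.length = n + (2 ^ k - 1) * n := by
    intro n
    simp
    ring
  have hMm : ∀ n, ∀ a ∈ (List.replicate n (Sym.selfSim (s + 1) ::
      List.replicate (2 ^ k - 1) (Sym.sig s))).flatten, a = .sig s ∨ a = .selfSim (s + 1) := by
    intro n a ha
    simp only [List.mem_flatten, List.mem_replicate] at ha
    obtain ⟨l, ⟨_, rfl⟩, ha⟩ := ha
    simp only [List.mem_cons, List.mem_replicate] at ha
    tauto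
  unfold layer selfCount extra
  by_cases h : s + 2 ≤ 2 ^ (k - 1)
  · simp only [if_pos h]
    refine ⟨List.replicate (2 ^ idx s - off s - 1) (.sig s), .rest s, .sig s, off s, ?_, ?_, ?_, ?_⟩
    · simp [one, root]
    · simp [isVirt]
    · intro a ha; exact .inl (List.eq_of_mem_replicate ha)
    · simp; omega
  · have h2 := second_case hk h
    simp only [if_neg h, hM]
    have fin : ∀ (l : List Sym) (p r : Sym) (b : ℕ) (X : List (BTree Sym)),
        X = l.map leaf ++ node (leaf p) (leaf r) :: List.replicate b (pair s) →
        List.map leaf (List.replicate (cycle k s) (Sym.selfSim (s + 1) ::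
          List.replicate (2 ^ k - 1) (Sym.sig s))).flatten ++ X =
        List.map leaf ((List.replicate (cycle k s) (Sym.selfSim (s + 1) ::
          List.replicate (2 ^ k - 1) (Sym.sig s))).flatten ++ l) ++
            node (leaf p) (leaf r) :: List.replicate b (pair s) := by
      rintro l p r b X rfl
      simp
    by_cases c1 : pos k s + 3 ≤ 2 ^ (k - 1)
    · simp only [if_pos c1, if_pos (show pos k s + 3 ≤ 2 ^ k by omega)]
      refine ⟨_ ++ List.replicate (2 ^ (k - 1) - pos k s - 1) (.sig s), .rest s, .sig s, pos k s,
        fin _ _ _ _ _ ?_, ?_, ?_, .inl ⟨rfl, rfl, by simp, ?_⟩⟩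
      · simp [one, root]
      · rw [List.filter_append, hMf]; simp [isVirt]
      · intro a ha
        rcases List.mem_append.mp ha with ha | ha
        · exact hMm _ a ha
        · exact .inl (List.eq_of_mem_replicate ha)
      · rw [List.length_append, hMl, List.length_replicate]; omega
    by_cases c2 : pos k s + 2 = 2 ^ (k - 1)
    · simp only [if_neg c1, if_pos c2, if_pos (show pos k s + 3 ≤ 2 ^ k by omega),
        if_pos (show pos k s + 4 ≤ 2 ^ k by omega)]
      refine ⟨_ ++ [], .unif (k - 1) (s + 1), .rest s, 2 ^ (k - 1) - 1,
        fin _ _ _ _ _ ?_, ?_, ?_, .inr ⟨rfl, rfl, .inl rfl, ?_⟩⟩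
      · simp [root]
      · rw [List.append_nil, hMf]
      · intro a ha
        rw [List.append_nil] at ha
        exact hMm _ a ha
      · rw [List.length_append, hMl, List.length_nil]; omega
    by_cases c3 : pos k s + 4 ≤ 2 ^ k
    · simp only [if_neg c1, if_neg c2, if_pos c3, if_pos (show pos k s + 3 ≤ 2 ^ k by omega)]
      refine ⟨_ ++ List.replicate (3 * 2 ^ (k - 1) - 2 - pos k s) (.sig s), .unif (k - 1) (s + 1),
        .rest s, pos k s + 1 - 2 ^ (k - 1),
        fin _ _ _ _ _ ?_, ?_, ?_, .inr ⟨rfl, rfl, .inl rfl, ?_⟩⟩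
      · simp [one, root]
      · rw [List.filter_append, hMf]; simp [isVirt]
      · intro a ha
        rcases List.mem_append.mp ha with ha | ha
        · exact hMm _ a ha
        · exact .inl (List.eq_of_mem_replicate ha)
      · rw [List.length_append, hMl, List.length_replicate]; omega
    by_cases c4 : pos k s + 3 = 2 ^ k
    · simp only [if_neg c1, if_neg c2, if_neg c3, if_pos c4, if_pos c4.le]
      refine ⟨_ ++ List.replicate (2 ^ (k - 1) + 1) (.sig s), .selfSimMinus (s + 1),
        .rest s, 2 ^ (k - 1) - 2,
        fin _ _ _ _ _ ?_, ?_, ?_, .inr ⟨rfl, rfl, .inr rfl, ?_⟩⟩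
      · simp [one, root]
      · rw [List.filter_append, hMf]; simp [isVirt]
      · intro a ha
        rcases List.mem_append.mp ha with ha | ha
        · exact hMm _ a ha
        · exact .inl (List.eq_of_mem_replicate ha)
      · rw [List.length_append, hMl, List.length_replicate]; omega
    · simp only [if_neg c1, if_neg c2, if_neg c3, if_neg c4,
        if_neg (show ¬ pos k s + 3 ≤ 2 ^ k by omega)]
      refine ⟨_ ++ .selfSim (s + 1) :: List.replicate (2 ^ (k - 1) - 1) (.sig s), .rest s, .sig s,
        2 ^ (k - 1) - 1, fin _ _ _ _ _ ?_, ?_, ?_, .inl ⟨rfl, rfl, by simp, ?_⟩⟩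
      · simp [one, root]
      · rw [List.filter_append, hMf, hf, List.replicate_succ']
      · intro a ha
        rcases List.mem_append.mp ha with ha | ha
        · exact hMm _ a ha
        · rcases List.mem_cons.mp ha with rfl | ha
          · exact .inr rfl
          · exact .inl (List.eq_of_mem_replicate ha)
      · rw [List.length_append, hMl, List.length_cons, List.length_replicate]; omega

/-! ## Consistency of the layers -/

theorem flatMap_filter_eq {α β : Type} (l : List α) (p : α → Bool) (f g : α → List β)
    (h0 : ∀ a ∈ l, p a = false → f a = []) (h1 : ∀ a ∈ l, p a = true → f a = g a) :
    l.flatMap f = (l.filter p).flatMap g := by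
  induction l with
  | nil => rfl
  | cons a l ih =>
    simp only [List.mem_cons, forall_eq_or_imp] at h0 h1
    cases h : p a with
    | false => simp [List.flatMap_cons, h0.1 h, h, ih h0.2 h1.2]
    | true => simp [List.flatMap_cons, h1.1 h, h, ih h0.2 h1.2]

theorem selfCount_ne_zero {k s : ℕ} {pre : List Sym}
    (hpre : pre.filter isVirt = List.replicate (selfCount k s) (.selfSim (s + 1)))
    (h : Sym.selfSim (s + 1) ∈ pre) : selfCount k s ≠ 0 := by
  intro h0
  have : Sym.selfSim (s + 1) ∈ pre.filter isVirt := List.mem_filter.mpr ⟨h, rfl⟩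
  rw [hpre, h0] at this
  simp at this

theorem level_unfold {k : ℕ} (hk : 1 < k) (v : Sym) : level (height k v) (unfold k v) = sub k v := by
  rw [unfold_eq, level_uniform _ _ (length_sub hk v)]

theorem allAbove_unfold (k : ℕ) (p : Sym → Prop) (v : Sym) :
    AllAbove p (height k v) (unfold k v) := by
  rw [unfold_eq]
  exact allAbove_uniform p _ _

/-- Unfolding layer `s` once gives layer `s + 1`, and only signatures stay above it. -/
theorem unfold_layer {k : ℕ} (hk : 1 < k) (s : ℕ) :
    ((layer k s).flatMap fun t => level (rootDepth k (s + 1) + 1) (t.bind (unfold k)))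
        = layer k (s + 1) ∧
      ∀ t ∈ layer k s, AllAbove (fun a => isVirt a = false) (rootDepth k (s + 1) + 1)
        (t.bind (unfold k)) := by
  obtain ⟨pre, p, r, b, hl, hf, hm, hpr⟩ := layer_shape hk s
  -- Positivity of the depth matters: the two leaves of a pair lie one level down and must end
  -- strictly above the next layer.
  obtain ⟨h, hh⟩ : ∃ h, rootDepth k (s + 1) = h + 1 := ⟨_, (Nat.sub_add_cancel (rootDepth_pos hk s)).symm⟩
  -- L_k sits one level higher than R_s and unfolds one level deeper, k = (k - 1) + 1, so both reach
  -- the same level.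
  have hself : Sym.selfSim (s + 1) ∈ pre → rootDepth k (s + 1) + 1 = height k (.selfSim (s + 1)) := by
    intro hmem
    rw [rootDepth_of_selfCount (selfCount_ne_zero hf hmem)]
    simp only [height]
    omega
  have hrest : rootDepth k (s + 1) = height k (.rest s) := rfl
  have hsig : ∀ t, unfold k (.sig t) = leaf (.sig t) := fun _ => rfl
  have hex : ∀ v ∈ extra k s, rootDepth k (s + 1) = height k v := fun v hv => (height_extra hv).1.symm
  rw [layer_succ hk, hl, virt]
  constructor
  · have h1 : ((pre.map leaf).flatMap fun t => level (rootDepth k (s + 1) + 1) (t.bind (unfold k)))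
        = (pre.filter isVirt).flatMap (sub k) := by
      rw [List.flatMap_map]
      apply flatMap_filter_eq
      · intro a ha hv
        rcases hm a ha with rfl | rfl
        · simp [BTree.bind, hsig, level]
        · cases hv
      · intro a ha hv
        rcases hm a ha with rfl | rfl
        · cases hv
        · rw [hself ha]
          exact level_unfold hk _
    have h2 : ((List.replicate b (pair s)).flatMap
        fun t => level (rootDepth k (s + 1) + 1) (t.bind (unfold k))) = [] := by
      rw [List.flatMap_eq_nil_iff]
      intro t ht
      rw [List.eq_of_mem_replicate ht, hh]
      simp [pair, one, BTree.bind, hsig, level]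
    rw [List.flatMap_append, List.flatMap_cons, h1, h2, hf, List.append_nil, List.flatMap_append,
      List.flatMap_append, List.append_assoc]
    congr 1
    rw [BTree.bind, BTree.bind, BTree.bind, level]
    rcases hpr with ⟨rfl, rfl, he, _⟩ | ⟨rfl, he, _, _⟩
    · rw [he, hrest, level_unfold hk, ← hrest, hh, hsig]
      simp [level]
    · rw [hex p (by simp [he]), level_unfold hk, ← hex p (by simp [he]), hrest, level_unfold hk, he]
      simp
  · intro t ht
    simp only [List.mem_append, List.mem_cons, List.mem_map, List.mem_replicate] at ht
    rcases ht with ⟨a, ha, rfl⟩ | rfl | ⟨_, rfl⟩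
    · rcases hm a ha with rfl | rfl
      · rfl
      · rw [hself ha]
        exact allAbove_unfold k _ _
    · rcases hpr with ⟨rfl, rfl, he, _⟩ | ⟨rfl, he, _, _⟩
      · refine ⟨allAbove_unfold k _ (.rest s), ?_⟩
        rw [hh]
        rfl
      · refine ⟨?_, allAbove_unfold k _ (.rest s)⟩
        rw [hex p (by simp [he])]
        exact allAbove_unfold k _ p
    · rw [hh]
      exact ⟨rfl, rfl⟩

theorem layer_zero {k : ℕ} (hk : 1 < k) : layer k 0 = [node (root 0) (one 0)] := by
  have := (two_pow_facts hk).2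
  simp [layer, this, idx, off]

theorem stage_zero {k : ℕ} (hk : 1 < k) : stage k 0 = node (root 0) (one 0) := by
  have := (two_pow_facts hk).2
  simp [stage, rootTree, this, idx, off, uniform]

/-- The levels alone do not support the induction. That all virtual symbols lie at or below the
level of the layer is carried along, since everything above it then stays fixed under unfolding. -/
theorem exists_level_stage {k : ℕ} (hk : 1 < k) (s : ℕ) :
    ∃ d, AllAbove (fun a => isVirt a = false) d (stage k s) ∧ level d (stage k s) = layer k s := by
  induction s with
  | zero => exact ⟨0, trivial, by rw [layer_zero hk, stage_zero hk, level]⟩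
  | succ s ih =>
    obtain ⟨d, h1, h2⟩ := ih
    have hp : ∀ a, isVirt a = false → unfold k a = leaf a := by
      rintro (_ | _ | _ | _ | _) h <;> first | rfl | cases h
    refine ⟨d + (rootDepth k (s + 1) + 1), ?_, ?_⟩
    · exact allAbove_bind hp _ _ _ h1 (h2 ▸ (unfold_layer hk s).2)
    · rw [stage, level_bind hp _ (by omega) _ _ h1, h2, (unfold_layer hk s).1]

/-! ## The labels of the stages -/

theorem labels_unfold {k : ℕ} (hk : 1 < k) (v : Sym) :
    (unfold k v).labels = (sub k v).flatMap labels := by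
  rw [unfold_eq, labels_uniform _ _ (length_sub hk v)]

/-- The length equation in `layer_shape` is what makes the number of leaves s + 1; the order is
forgotten by passing to multisets. -/
theorem labels_layer {k : ℕ} (hk : 1 < k) (s : ℕ) :
    (((layer k s).flatMap labels : List Sym) : Multiset Sym)
      = Multiset.replicate (s + 1) (.sig s) + (virt k s : Multiset Sym) := by
  obtain ⟨pre, p, r, b, hl, hf, hm, hpr⟩ := layer_shape hk s
  have h1 : (pre.map leaf).flatMap labels = pre := by
    rw [List.flatMap_map]
    simp [labels]
  have h2 : (List.replicate b (pair s)).flatMap labels = List.replicate (b * 2) (.sig s) := by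
    clear hl hpr
    induction b with
    | zero => rfl
    | succ b ih =>
      rw [List.replicate_succ, List.flatMap_cons, ih, show (b + 1) * 2 = b * 2 + 1 + 1 by ring]
      rfl
  have h3 : (pre : Multiset Sym) = Multiset.replicate (selfCount k s) (.selfSim (s + 1)) +
      Multiset.replicate (pre.length - selfCount k s) (.sig s) := by
    have h4 := Multiset.filter_add_not (fun a => isVirt a = true) (pre : Multiset Sym)
    have h5 : Multiset.filter (fun a => isVirt a = true) (pre : Multiset Sym)
        = Multiset.replicate (selfCount k s) (.selfSim (s + 1)) := by
      rw [Multiset.filter_coe, ← Multiset.coe_replicate, ← hf]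
      simp
    have h6 : Multiset.filter (fun a => ¬ isVirt a = true) (pre : Multiset Sym)
        = Multiset.replicate (Multiset.filter (fun a => ¬ isVirt a = true) (pre : Multiset Sym)).card
          (.sig s) := by
      rw [Multiset.eq_replicate]
      refine ⟨rfl, fun a ha => ?_⟩
      rw [Multiset.mem_filter] at ha
      rcases hm a ha.1 with rfl | rfl
      · rfl
      · exact absurd rfl ha.2
    have h7 := congrArg Multiset.card h4
    rw [h5, Multiset.card_add, Multiset.card_replicate, Multiset.coe_card] at h7
    rw [← h4, h6, h5]
    congr 2
    omega
  have hle : selfCount k s ≤ pre.length := by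
    have := List.length_filter_le isVirt pre
    rwa [hf, List.length_replicate] at this
  rw [hl, List.flatMap_append, List.flatMap_cons, h1, h2, ← Multiset.coe_add, h3, virt,
    ← Multiset.coe_add, ← Multiset.coe_add, ← Multiset.coe_add, Multiset.coe_replicate,
    Multiset.coe_replicate, show ((leaf p).node (leaf r)).labels = [p] ++ [r] from rfl,
    ← Multiset.coe_add, Multiset.coe_singleton, Multiset.coe_singleton, Multiset.coe_singleton]
  rcases hpr with ⟨rfl, rfl, he, hn⟩ | ⟨rfl, he, _, hn⟩
  · rw [he, show s + 1 = (pre.length - selfCount k s) + b * 2 + 1 by omega, Multiset.replicate_add,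
      Multiset.replicate_add, Multiset.replicate_one, Multiset.coe_nil]
    abel
  · rw [he, show s + 1 = (pre.length - selfCount k s) + b * 2 by omega, Multiset.replicate_add,
      Multiset.coe_singleton]
    abel

/-- All leaves of signature less than `s`. -/
def sigs (s : ℕ) : Multiset Sym :=
  ((List.range s).flatMap fun t => List.replicate (t + 1) (.sig t) : List Sym)

theorem sigs_succ (s : ℕ) : sigs (s + 1) = sigs s + Multiset.replicate (s + 1) (.sig s) := by
  rw [sigs, List.range_succ, List.flatMap_append, ← Multiset.coe_add, ← sigs]
  simp [List.replicate_succ, ← Multiset.coe_replicate]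

theorem sigs_zero : sigs 0 = 0 := rfl

theorem mem_sigs {s : ℕ} {a : Sym} (h : a ∈ sigs s) : ∃ t < s, a = .sig t := by
  simp only [sigs, Multiset.mem_coe, List.mem_flatMap, List.mem_range, List.mem_replicate] at h
  obtain ⟨t, ht, _, h⟩ := h
  exact ⟨t, ht, h⟩

theorem bind_sigs (k s : ℕ) : ((sigs s).bind fun a => ((unfold k a).labels : Multiset Sym)) = sigs s := by
  conv_rhs => rw [← Multiset.map_id (sigs s), ← Multiset.bind_singleton]
  apply Multiset.bind_congr
  intro a ha
  obtain ⟨t, _, rfl⟩ := mem_sigs ha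
  rfl

/-- The leaves of stage `s`: all leaves of signature at most `s`, and the virtual symbols of
layer `s`. -/
theorem labels_stage {k : ℕ} (hk : 1 < k) (s : ℕ) :
    ((stage k s).labels : Multiset Sym) = sigs (s + 1) + (virt k s : Multiset Sym) := by
  induction s with
  | zero =>
    have h := labels_layer hk 0
    rw [layer_zero hk] at h
    rw [stage_zero hk, sigs_succ, sigs_zero, zero_add]
    simpa using h
  | succ s ih =>
    rw [stage, labels_bind, ← Multiset.coe_bind, ih, Multiset.add_bind,
      bind_sigs, Multiset.coe_bind, sigs_succ (s + 1),
      add_assoc, ← labels_layer hk, layer_succ hk, List.flatMap_assoc]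
    congr 2
    simp only [labels_unfold hk]

/-! ## Weights of the symbols -/

/-- The weight of all pairs in the subtree of a symbol, up to the factor `(1 - q) ^ 2`, for
`q = 2 ^ (-k)`. -/
noncomputable def wt (k : ℕ) : Sym → ℝ
  | .sig s => ((1 / 2 : ℝ) ^ k) ^ s
  | .unif m s => 2 ^ m * ((1 / 2 : ℝ) ^ k) ^ s
  -- The solution of W = 2^k - 1 + qW is W = 2^k; the weight of L_k⁻ is then 2^(k-1) - 1 + q·2^k =
  -- 2^(k-1).
  | .selfSim s => 2 ^ k * ((1 / 2 : ℝ) ^ k) ^ s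
  | .selfSimMinus s => 2 ^ (k - 1) * ((1 / 2 : ℝ) ^ k) ^ s
  -- The tail ∑_{t>s} (t+1) q^t equals q^s ((s+2)/N + 1/N^2) with N = 2^k - 1 = (1-q)/q. The other
  -- virtual symbols are subtracted: q^s for each L_k, and q^s/2 for the additional symbol.
  | .rest s => ((1 / 2 : ℝ) ^ k) ^ s *
      ((s + 2 + 1 / (2 ^ k - 1)) / (2 ^ k - 1) - selfCount k s - (extra k s).length / 2)

theorem two_pow_mul_half (k s : ℕ) :
    2 ^ k * ((1 / 2 : ℝ) ^ k) ^ (s + 1) = ((1 / 2 : ℝ) ^ k) ^ s := by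
  rw [pow_succ, mul_comm, mul_assoc, ← mul_pow]
  norm_num

theorem two_pow_pred {k : ℕ} (hk : 1 < k) : (2 : ℝ) ^ k = 2 * 2 ^ (k - 1) := by
  exact_mod_cast (two_pow_facts hk).1

theorem four_le_two_pow {k : ℕ} (hk : 1 < k) : (4 : ℝ) ≤ 2 ^ k := by
  have := two_pow_facts hk
  have : 4 ≤ 2 ^ k := by omega
  exact_mod_cast this

theorem wt_selfSim (k s : ℕ) : wt k (.selfSim (s + 1)) = ((1 / 2 : ℝ) ^ k) ^ s :=
  two_pow_mul_half k s

theorem length_extra_le (k s : ℕ) : (extra k s).length ≤ 1 := by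
  unfold extra
  split_ifs <;> simp

theorem wt_extra {k : ℕ} (hk : 1 < k) {s : ℕ} {v : Sym} (hv : v ∈ extra k s) :
    wt k v = ((1 / 2 : ℝ) ^ k) ^ s / 2 := by
  have h := two_pow_mul_half k s
  rw [two_pow_pred hk] at h
  unfold extra at hv
  split_ifs at hv <;> simp only [List.not_mem_nil, List.mem_singleton] at hv <;> subst hv <;>
    simp only [wt] <;> linarith

theorem sum_wt_extra {k : ℕ} (hk : 1 < k) (s : ℕ) :
    ((extra k s).map (wt k)).sum = (extra k s).length * (((1 / 2 : ℝ) ^ k) ^ s / 2) := by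
  have : (extra k s).map (wt k) = (extra k s).map fun _ => ((1 / 2 : ℝ) ^ k) ^ s / 2 :=
    List.map_congr_left fun v hv => wt_extra hk hv
  rw [this]
  simp

theorem sum_wt_virt {k : ℕ} (hk : 1 < k) (s : ℕ) :
    ((virt k s).map (wt k)).sum
      = ((1 / 2 : ℝ) ^ k) ^ s * ((s + 2 + 1 / (2 ^ k - 1)) / (2 ^ k - 1)) := by
  simp only [virt, List.map_append, List.sum_append, sum_wt_extra hk, List.map_replicate,
    List.sum_replicate, wt_selfSim, List.map_cons, List.map_nil, List.sum_singleton, nsmul_eq_mul]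
  rw [wt]
  ring

theorem sum_weight_layer {k : ℕ} (hk : 1 < k) (s : ℕ) :
    ((layer k s).map (weight (wt k))).sum = (s + 1) * ((1 / 2 : ℝ) ^ k) ^ s
      + ((virt k s).map (wt k)).sum := by
  have h := congrArg (fun m => (m.map (wt k)).sum) (labels_layer hk s)
  simp only [Multiset.map_coe, Multiset.sum_coe, sum_map_weight, Multiset.map_add, Multiset.sum_add,
    Multiset.map_replicate, Multiset.sum_replicate, nsmul_eq_mul] at h
  rw [h]
  simp [wt]

/-- The unfolding of a symbol has the weight of the symbol. -/
theorem sum_weight_sub {k : ℕ} (hk : 1 < k) (v : Sym) :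
    ((sub k v).map (weight (wt k))).sum = wt k v := by
  have h4 := four_le_two_pow hk
  have hc1 : ((2 ^ k - 1 : ℕ) : ℝ) = 2 ^ k - 1 := by
    rw [Nat.cast_sub Nat.one_le_two_pow]; simp
  have hc2 : ((2 ^ (k - 1) - 1 : ℕ) : ℝ) = 2 ^ (k - 1) - 1 := by
    rw [Nat.cast_sub Nat.one_le_two_pow]; simp
  have main : ∀ v, (∀ s, v ≠ .rest s) → ((sub k v).map (weight (wt k))).sum = wt k v := by
    rintro (s | ⟨m, s⟩ | s | s | s) hv
    · simp [sub, one]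
    · simp [sub, one, wt]
    · simp only [sub, one, List.map_cons, List.sum_cons, weight_leaf, wt_selfSim,
        List.map_replicate, List.sum_replicate, nsmul_eq_mul, hc1]
      simp only [wt]
      ring
    · simp only [sub, one, List.map_cons, List.sum_cons, weight_leaf, wt_selfSim,
        List.map_replicate, List.sum_replicate, nsmul_eq_mul, hc2]
      simp only [wt]
      ring
    · exact absurd rfl (hv s)
  by_cases hv : ∀ s, v ≠ .rest s
  · exact main v hv
  push Not at hv
  obtain ⟨s, rfl⟩ := hv
  -- For R_s no inspection of its tree is needed: the weight of layer s + 1 is known, and all its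
  -- parts other than the unfolding of R_s have been computed.
  have h1 := sum_weight_layer hk (s + 1)
  have hsub : ∀ l : List Sym, ((l.flatMap (sub k)).map (weight (wt k))).sum
      = (l.map fun v => ((sub k v).map (weight (wt k))).sum).sum := by
    intro l
    induction l with
    | nil => rfl
    | cons a l ih => simp [ih]
  have hex : ((extra k s).map fun v => ((sub k v).map (weight (wt k))).sum)
      = (extra k s).map (wt k) := by
    apply List.map_congr_left
    intro v hv
    apply main
    rintro t rfl
    unfold extra at hv
    split_ifs at hv <;> simp at hv
  rw [layer_succ hk, hsub, sum_wt_virt hk] at h1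
  simp only [virt, List.map_append, List.sum_append, hex, sum_wt_extra hk, List.map_replicate,
    List.sum_replicate, List.map_cons, List.map_nil, List.sum_singleton, nsmul_eq_mul,
    main (.selfSim (s + 1)) (by simp), wt_selfSim] at h1
  have h2 : ((sub k (.rest s)).map (weight (wt k))).sum
      = (((s + 1 : ℕ) : ℝ) + 1) * ((1 / 2 : ℝ) ^ k) ^ (s + 1) + ((1 / 2 : ℝ) ^ k) ^ (s + 1) *
        ((((s + 1 : ℕ) : ℝ) + 2 + 1 / (2 ^ k - 1)) / (2 ^ k - 1))
        - selfCount k s * ((1 / 2 : ℝ) ^ k) ^ s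
        - (extra k s).length * (((1 / 2 : ℝ) ^ k) ^ s / 2) := by linarith
  rw [h2, wt]
  have hq : (1 / 2 : ℝ) ^ k = 1 / ((2 ^ k - 1) + 1) := by
    rw [sub_add_cancel, one_div_pow]
  generalize hN : (2 : ℝ) ^ k - 1 = N at *
  have hN0 : N ≠ 0 := by linarith
  have hN1 : N + 1 ≠ 0 := by linarith
  -- The tail after s splits into the terms of signature s + 1 and the tail after s + 1.
  have key : (((s + 1 : ℕ) : ℝ) + 1) * (1 / 2 : ℝ) ^ k + (1 / 2 : ℝ) ^ k *
      ((((s + 1 : ℕ) : ℝ) + 2 + 1 / N) / N) = (s + 2 + 1 / N) / N := by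
    rw [hq]
    push_cast
    field_simp
    ring
  rw [pow_succ]
  linear_combination ((1 / 2 : ℝ) ^ k) ^ s * key

theorem weight_unfold {k : ℕ} (hk : 1 < k) (v : Sym) : weight (wt k) (unfold k v) = wt k v := by
  rw [unfold_eq, weight_uniform _ _ _ (length_sub hk v), sum_weight_sub hk]

/-- The integer form of the bounds on R_s, doubled to clear the half weight of the additional
symbol. The extra 1 on the left absorbs the summand 1/(2^k - 1) ≤ 1/2 of the tail. -/
theorem virtual_bounds {k : ℕ} (hk : 1 < k) (s : ℕ) :
    2 * (s + 2) + 1 ≤ (2 ^ k - 1) * (2 + 2 * selfCount k s + (extra k s).length) ∧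
      (2 ^ k - 1) * (2 * selfCount k s + 2 * (extra k s).length) ≤ 2 * (s + 2) := by
  obtain ⟨h3, h4⟩ := two_pow_facts hk
  by_cases h : s + 2 ≤ 2 ^ (k - 1)
  · simp only [selfCount, extra, if_pos h, List.length_nil, mul_add, mul_zero]
    omega
  · have h2 := second_case hk h
    simp only [selfCount, extra, if_neg h]
    split_ifs <;> simp only [mul_add, List.length_nil, List.length_singleton, mul_zero,
      mul_left_comm _ 2] <;> omega

/-- There are s + 2 pairs of signature s + 1, so distinct ones can stand in for the virtual symbols
in `treeCost_stage_le`. -/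
theorem length_virt_le {k : ℕ} (hk : 1 < k) (s : ℕ) : (virt k s).length ≤ s + 2 := by
  have h1 := (virtual_bounds hk s).2
  obtain ⟨h3, h4⟩ := two_pow_facts hk
  have h5 : 3 * (2 * selfCount k s + 2 * (extra k s).length)
      ≤ (2 ^ k - 1) * (2 * selfCount k s + 2 * (extra k s).length) :=
    Nat.mul_le_mul_right _ (by omega)
  simp only [virt, List.length_append, List.length_replicate, List.length_singleton]
  omega

/-- The upper bound places R_s among the weights to be merged first. The lower bound makes R_s and
its sibling together weigh at least q^s: a sibling leaf already weighs q^s, while an additional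
symbol weighs only half of it and R_s supplies the other half. -/
theorem wt_rest_bounds {k : ℕ} (hk : 1 < k) (s : ℕ) :
    (extra k s).length * (((1 / 2 : ℝ) ^ k) ^ s / 2) ≤ wt k (.rest s) ∧
      wt k (.rest s) ≤ ((1 / 2 : ℝ) ^ k) ^ s := by
  obtain ⟨h1, h2⟩ := virtual_bounds hk s
  have h4 := four_le_two_pow hk
  have hc1 : ((2 ^ k - 1 : ℕ) : ℝ) = 2 ^ k - 1 := by
    rw [Nat.cast_sub Nat.one_le_two_pow]; simp
  have h1' : (2 * (s + 2) + 1 : ℝ) ≤ (2 ^ k - 1) * (2 + 2 * selfCount k s + (extra k s).length) := by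
    rw [← hc1]; exact_mod_cast h1
  have h2' : (2 ^ k - 1 : ℝ) * (2 * selfCount k s + 2 * (extra k s).length) ≤ 2 * (s + 2) := by
    rw [← hc1]; exact_mod_cast h2
  have hq : (0 : ℝ) ≤ ((1 / 2 : ℝ) ^ k) ^ s := by positivity
  rw [wt]
  generalize hN : (2 : ℝ) ^ k - 1 = N at *
  generalize ((1 / 2 : ℝ) ^ k) ^ s = x at *
  have hN3 : 3 ≤ N := by linarith
  have hN0 : 0 < N := by linarith
  have hi : 0 ≤ 1 / N := by positivity
  have hi' : 1 / N ≤ 1 / 2 := one_div_le_one_div_of_le (by norm_num) (by linarith)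
  have lo : selfCount k s + ((extra k s).length : ℝ) ≤ (s + 2 + 1 / N) / N := by
    rw [le_div_iff₀ hN0]; linarith
  have hi : (s + 2 + 1 / N) / N ≤ 1 + selfCount k s + ((extra k s).length : ℝ) / 2 := by
    rw [div_le_iff₀ hN0]; linarith
  constructor
  · nlinarith
  · nlinarith

theorem wt_nonneg {k : ℕ} (hk : 1 < k) (v : Sym) : 0 ≤ wt k v := by
  have hq : (0 : ℝ) ≤ (1 / 2 : ℝ) ^ k := by positivity
  cases v with
  | rest s => exact le_trans (by positivity) (wt_rest_bounds hk s).1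
  | _ => simp only [wt]; positivity

theorem wt_virt_le {k : ℕ} (hk : 1 < k) {s : ℕ} {v : Sym} (hv : v ∈ virt k s) :
    wt k v ≤ ((1 / 2 : ℝ) ^ k) ^ s := by
  have hq : (0 : ℝ) ≤ ((1 / 2 : ℝ) ^ k) ^ s := by positivity
  simp only [virt, List.mem_append, List.mem_replicate, List.mem_singleton] at hv
  rcases hv with (⟨_, rfl⟩ | hv) | rfl
  · rw [wt_selfSim]
  · rw [wt_extra hk hv]; linarith
  · exact (wt_rest_bounds hk s).2

/-! ## Optimality of the stages -/

/-- The weights of a layer, and the merging of its lower level. -/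
theorem layer_weights {k : ℕ} (hk : 1 < k) (s : ℕ) :
    ((layer k s).map (weight (wt k))).Pairwise (· ≤ ·) ∧
    (∀ w ∈ (layer k s).map (weight (wt k)),
      ((1 / 2 : ℝ) ^ k) ^ s ≤ w ∧ w ≤ 2 * ((1 / 2 : ℝ) ^ k) ^ s) ∧
    ∀ (W : Multiset ℝ) (c : ℝ), (∀ w ∈ W, ((1 / 2 : ℝ) ^ k) ^ s ≤ w) →
      CostBound (((layer k s).map (weight (wt k)) : List ℝ) + W) c →
      CostBound ((((layer k s).flatMap labels).map (wt k) : List ℝ) + W)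
        (c + ((layer k s).map (treeCost (wt k))).sum) := by
  obtain ⟨pre, p, r, b, hl, hf, hm, hpr⟩ := layer_shape hk s
  have hR := wt_rest_bounds hk s
  have hx : (0 : ℝ) ≤ ((1 / 2 : ℝ) ^ k) ^ s := by positivity
  have hsig : wt k (.sig s) = ((1 / 2 : ℝ) ^ k) ^ s := rfl
  have hself := wt_selfSim k s
  have hp0 := wt_nonneg hk p
  have hr0 := wt_nonneg hk r
  have hbd : wt k p ≤ ((1 / 2 : ℝ) ^ k) ^ s ∧ wt k r ≤ ((1 / 2 : ℝ) ^ k) ^ s ∧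
      ((1 / 2 : ℝ) ^ k) ^ s ≤ wt k p + wt k r := by
    rcases hpr with ⟨rfl, rfl, he, _⟩ | ⟨rfl, he, _, _⟩
    · rw [hsig]
      exact ⟨hR.2, le_rfl, by linarith⟩
    · have := wt_extra hk (s := s) (v := p) (by simp [he])
      rw [he] at hR
      simp only [List.length_singleton, Nat.cast_one, one_mul] at hR
      refine ⟨by linarith, hR.2, by linarith⟩
  have hpre : pre.map (wt k) = List.replicate pre.length (((1 / 2 : ℝ) ^ k) ^ s) := by
    rw [List.eq_replicate_iff]
    refine ⟨by simp, fun w hw => ?_⟩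
    obtain ⟨a, ha, rfl⟩ := List.mem_map.mp hw
    rcases hm a ha with rfl | rfl
    · exact hsig
    · exact hself
  have hw : (layer k s).map (weight (wt k)) = List.replicate pre.length (((1 / 2 : ℝ) ^ k) ^ s) ++
      (wt k p + wt k r) :: List.replicate b (2 * ((1 / 2 : ℝ) ^ k) ^ s) := by
    have h2 : weight (wt k) (pair s) = 2 * ((1 / 2 : ℝ) ^ k) ^ s := by
      simp [pair, one, hsig]; ring
    rw [hl, ← hpre]
    simp [h2, Function.comp_def]
  have hlab : (((layer k s).flatMap labels).map (wt k) : List ℝ)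
      = List.replicate pre.length (((1 / 2 : ℝ) ^ k) ^ s) ++
      (wt k p :: wt k r :: List.replicate (b * 2) (((1 / 2 : ℝ) ^ k) ^ s)) := by
    have h2 : ((List.replicate b (pair s)).flatMap labels).map (wt k)
        = List.replicate (b * 2) (((1 / 2 : ℝ) ^ k) ^ s) := by
      clear hl hpr hw
      induction b with
      | zero => rfl
      | succ b ih =>
        rw [List.replicate_succ, List.flatMap_cons, List.map_append, ih,
          show (b + 1) * 2 = b * 2 + 1 + 1 by ring]
        rfl
    rw [hl, ← hpre, List.flatMap_append, List.map_append, List.flatMap_cons, List.map_append, h2,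
      List.flatMap_map]
    simp [labels]
  have hcost : ((layer k s).map (treeCost (wt k))).sum
      = (wt k p + wt k r) + (List.replicate (b * 2) (((1 / 2 : ℝ) ^ k) ^ s)).sum := by
    rw [hl]
    simp [Function.comp_def, pair, one, hsig]
    ring
  refine ⟨?_, ?_, ?_⟩
  · rw [hw, List.pairwise_append, List.pairwise_cons]
    refine ⟨by simp [List.pairwise_replicate], ⟨?_, by simp [List.pairwise_replicate]⟩, ?_⟩
    · intro a ha
      rw [List.eq_of_mem_replicate ha]
      linarith
    · intro a ha c hc
      rw [List.eq_of_mem_replicate ha]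
      rcases List.mem_cons.mp hc with rfl | hc
      · exact hbd.2.2
      · rw [List.eq_of_mem_replicate hc]
        linarith
  · intro w hw'
    rw [hw] at hw'
    simp only [List.mem_append, List.mem_replicate, List.mem_cons] at hw'
    rcases hw' with ⟨_, rfl⟩ | rfl | ⟨_, rfl⟩ <;> constructor <;> linarith
  · intro W c hW hc
    rw [hlab, hcost]
    rw [hw] at hc
    set x := ((1 / 2 : ℝ) ^ k) ^ s
    -- This describes the merges that follow the one of `p` and `r`: their sum, at least `x`, is
    -- already among the large weights while the leaves of the pairs are merged.
    have h1 := CostBound.of_mergePairs (u := x) (c := c) b (List.replicate (b * 2) x)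
      ((wt k p + wt k r) ::ₘ (Multiset.replicate pre.length x + W)) (by simp)
      (by simp [List.pairwise_replicate])
      (by intro w hw; rw [List.eq_of_mem_replicate hw]; exact ⟨hx, le_rfl⟩)
      (by
        intro w hw
        rw [mergePairs_replicate] at hw
        rw [List.eq_of_mem_replicate hw]
        linarith)
      (by
        intro w hw
        simp only [Multiset.mem_cons, Multiset.mem_add, Multiset.mem_replicate] at hw
        rcases hw with rfl | ⟨_, rfl⟩ | hw
        · exact hbd.2.2
        · exact le_rfl
        · exact hW w hw)
      (by
        rw [mergePairs_replicate]
        convert hc using 1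
        simp only [← Multiset.coe_add, ← Multiset.cons_coe, Multiset.coe_replicate,
          ← Multiset.singleton_add]
        abel)
    rw [Multiset.coe_replicate, Multiset.add_cons] at h1
    have hge : ∀ w ∈ Multiset.replicate (b * 2) x + (Multiset.replicate pre.length x + W), x ≤ w := by
      intro w hw
      simp only [Multiset.mem_add, Multiset.mem_replicate] at hw
      rcases hw with ⟨_, rfl⟩ | ⟨_, rfl⟩ | hw
      · exact le_rfl
      · exact le_rfl
      · exact hW w hw
    have h2 : CostBound (wt k p ::ₘ wt k r ::ₘ
        (Multiset.replicate (b * 2) x + (Multiset.replicate pre.length x + W)))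
        (c + (List.replicate (b * 2) x).sum + (wt k p + wt k r)) := by
      -- Either child can be the lighter one, and Huffman's step expects the smaller weight first.
      rcases le_total (wt k p) (wt k r) with hle | hle
      · exact CostBound.merge hp0 hle (fun w hw => hbd.2.1.trans (hge w hw)) h1
      · rw [Multiset.cons_swap, add_comm (wt k p)]
        rw [add_comm (wt k p)] at h1
        exact CostBound.merge hr0 hle (fun w hw => hbd.1.trans (hge w hw)) h1
    convert h2 using 1
    · simp only [← Multiset.coe_add, ← Multiset.cons_coe, Multiset.coe_replicate,
          ← Multiset.singleton_add]
      abel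
    · ring

/-- Merging layer `s + 1` into the virtual symbols of layer `s`. -/
theorem CostBound.of_virt {k : ℕ} (hk : 1 < k) (s : ℕ) (W : Multiset ℝ) (c : ℝ)
    (hW : ∀ w ∈ W, ((1 / 2 : ℝ) ^ k) ^ s ≤ w)
    (hc : CostBound (((virt k s).map (wt k) : List ℝ) + W) c) :
    CostBound (((layer k (s + 1)).map (weight (wt k)) : List ℝ) + W)
      (c + ((virt k s).map fun v => height k v * wt k v).sum) := by
  obtain ⟨hs, hb, _⟩ := layer_weights hk (s + 1)
  set x := ((1 / 2 : ℝ) ^ k) ^ (s + 1) with hxdef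
  set h := rootDepth k (s + 1) with hh
  have hx : 0 ≤ x := by positivity
  have hk2 : 2 ^ k * x = ((1 / 2 : ℝ) ^ k) ^ s := two_pow_mul_half k s
  have hhk : h < k := rootDepth_lt hk (s + 1)
  -- Either there is no constant prefix, or its trees have depth exactly h + 1 = k, so
  -- `CostBound.of_prefix` fits both cases.
  have hn : selfCount k s = 0 ∨ h + 1 = k := by
    by_cases h0 : selfCount k s = 0
    · exact .inl h0
    · have := rootDepth_of_selfCount h0
      exact .inr (by omega)
  have hself : ((sub k (.selfSim (s + 1))).map (weight (wt k))) = List.replicate (2 ^ k) x := by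
    rw [show 2 ^ k = (2 ^ k - 1) + 1 from (Nat.sub_add_cancel Nat.one_le_two_pow).symm,
      List.replicate_succ]
    simp only [sub, List.map_cons, weight_leaf, wt_selfSim, List.map_replicate, one]
    rfl
  set l := ((extra k s).flatMap (sub k) ++ sub k (.rest s)).map (weight (wt k)) with hldef
  have hrep : ∀ n, ((List.replicate n (Sym.selfSim (s + 1))).flatMap (sub k)).map (weight (wt k))
      = List.replicate (n * 2 ^ k) x := by
    intro n
    induction n with
    | zero => simp
    | succ n ih =>
      rw [List.replicate_succ, List.flatMap_cons, List.map_append, ih, hself, ← List.replicate_add]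
      congr 1
      ring
  have hlay : (layer k (s + 1)).map (weight (wt k))
      = List.replicate (selfCount k s * 2 ^ (h + 1)) x ++ l := by
    rw [layer_succ hk, virt, List.append_assoc, List.flatMap_append, List.map_append, hrep,
      List.flatMap_append, hldef]
    congr 2
    · rcases hn with h0 | h0
      · simp [h0]
      · rw [h0]
    · simp
  rw [hlay] at hs hb ⊢
  have hl : l.length = ((extra k s).length + 1) * 2 ^ h ∧
      mergePairs^[h] l = (extra k s).map (wt k) ++ [wt k (.rest s)] ∧
      l.sum = ((extra k s).map (wt k)).sum + wt k (.rest s) := by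
    have hr1 : ((sub k (.rest s)).map (weight (wt k))).length = 2 ^ h := by
      rw [List.length_map, length_sub hk]; rfl
    have hex := length_extra_le k s
    rcases hE : extra k s with _ | ⟨v, _ | _⟩
    · simp only [hldef, hE, List.flatMap_nil, List.nil_append]
      rw [mergePairs_iterate_eq_singleton _ _ hr1, sum_weight_sub hk, hr1]
      simp
    · have hv : ((sub k v).map (weight (wt k))).length = 2 ^ h := by
        rw [List.length_map, length_sub hk, (height_extra (k := k) (s := s) (by simp [hE])).1]
      simp only [hldef, hE, List.flatMap_cons, List.flatMap_nil, List.append_nil, List.map_append]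
      rw [mergePairs_iterate_append h 1 _ _ (by simpa using hv),
        mergePairs_iterate_eq_singleton _ _ hr1, mergePairs_iterate_eq_singleton _ _ hv,
        sum_weight_sub hk, sum_weight_sub hk, List.length_append, hr1, hv, List.sum_append,
        sum_weight_sub hk, sum_weight_sub hk]
      simp
      ring
    · rw [hE] at hex
      simp at hex
  rw [List.pairwise_append] at hs
  have hle : (2 : ℝ) ^ h * x ≤ ((1 / 2 : ℝ) ^ k) ^ s := by
    rw [← hk2]
    exact mul_le_mul_of_nonneg_right (pow_le_pow_right₀ (by norm_num) hhk.le) hx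
  have key := CostBound.of_prefix (c := c) (x := x) (W := W) h ((extra k s).length + 1)
    (selfCount k s) l hx hl.1 hs.2.1 (fun w hw => hb w (List.mem_append_right _ hw))
    (fun w hw => hle.trans (hW w hw)) (by
      rw [hl.2.1]
      convert hc using 2
      rw [virt, List.append_assoc, List.map_append, ← Multiset.coe_add, List.map_append,
        List.map_replicate, wt_selfSim, Multiset.coe_add, ← Multiset.coe_add (List.replicate _ _),
        Multiset.coe_replicate]
      congr 1
      rcases hn with h0 | h0
      · simp [h0]
      · rw [h0, hk2])
  rw [← Multiset.coe_add, Multiset.coe_replicate]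
  convert key using 1
  have hexs : ((extra k s).map fun v => height k v * wt k v).sum = h * ((extra k s).map (wt k)).sum := by
    rw [← List.sum_map_mul_left]
    congr 1
    apply List.map_congr_left
    intro v hv
    rw [(height_extra hv).1]
  rw [virt, List.map_append, List.map_append, List.sum_append, List.sum_append, hexs, hl.2.2,
    List.map_replicate, List.sum_replicate]
  simp only [List.map_cons, List.map_nil, List.sum_singleton, nsmul_eq_mul, wt_selfSim]
  have : (selfCount k s : ℝ) * ((height k (.selfSim (s + 1)) : ℝ) * ((1 / 2 : ℝ) ^ k) ^ s)
      = selfCount k s * ((h + 1) * (2 ^ (h + 1) * x)) := by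
    rcases hn with h0 | h0
    · simp [h0]
    · rw [h0, hk2, show height k (.selfSim (s + 1)) = k from rfl, ← h0]
      push_cast
      rfl
  rw [this, show height k (.rest s) = h from rfl]
  ring

/-- Splits the increment into the uniform trees above layer s + 1 and the siblings within that
layer, the two amounts charged by `CostBound.of_virt` and `layer_weights`. -/
theorem treeCost_stage_succ {k : ℕ} (hk : 1 < k) (s : ℕ) :
    treeCost (wt k) (stage k (s + 1)) = treeCost (wt k) (stage k s)
      + ((virt k s).map fun v => height k v * wt k v).sum
      + ((layer k (s + 1)).map (treeCost (wt k))).sum := by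
  rw [stage, treeCost_bind _ _ _ fun a _ => weight_unfold hk a]
  have h := congrArg (fun m => (m.map fun a => treeCost (wt k) (unfold k a)).sum) (labels_stage hk s)
  simp only [Multiset.map_coe, Multiset.sum_coe, Multiset.map_add, Multiset.sum_add] at h
  have h0 : ((sigs (s + 1)).map fun a => treeCost (wt k) (unfold k a)).sum = 0 := by
    apply Multiset.sum_eq_zero
    intro y hy
    obtain ⟨a, ha, rfl⟩ := Multiset.mem_map.mp hy
    obtain ⟨t, _, rfl⟩ := mem_sigs ha
    exact treeCost_leaf _ _
  have h1 : ∀ l : List Sym, (l.map fun a => treeCost (wt k) (unfold k a)).sum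
      = (l.map fun v => height k v * wt k v).sum
        + ((l.flatMap (sub k)).map (treeCost (wt k))).sum := by
    intro l
    induction l with
    | nil => simp
    | cons a l ih =>
      simp only [List.map_cons, List.sum_cons, ih, List.flatMap_cons, List.map_append,
        List.sum_append]
      rw [unfold_eq, treeCost_uniform _ _ _ (length_sub hk a), sum_weight_sub hk]
      ring
  rw [h, h0, h1, layer_succ hk]
  ring

/-- Every stage is an optimal tree for the weights of its leaves. -/
theorem costBound_stage {k : ℕ} (hk : 1 < k) (s : ℕ) :
    CostBound ((stage k s).labels.map (wt k) : List ℝ) (treeCost (wt k) (stage k s)) := by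
  have hq0 : (0 : ℝ) ≤ (1 / 2 : ℝ) ^ k := by positivity
  have hq1 : (1 / 2 : ℝ) ^ k ≤ 1 := pow_le_one₀ (by norm_num) (by norm_num)
  induction s with
  | zero =>
    have h := (layer_weights hk 0).2.2 0 0 (by simp) (by
      intro P hP _
      rw [layer_zero hk] at hP
      simp only [List.map_cons, List.map_nil, Multiset.coe_singleton, add_zero,
        Multiset.map_eq_singleton] at hP
      obtain ⟨p, rfl, hp⟩ := hP
      simp only [cost, Multiset.map_singleton, Multiset.sum_singleton, hp]
      have := wt_nonneg hk (.rest 0)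
      have := wt_nonneg hk (.sig 0)
      simp only [weight_node, root, one, weight_leaf]
      positivity)
    rw [layer_zero hk] at h
    rw [stage_zero hk]
    simpa using h
  | succ s ih =>
    have hlab : ∀ s, ((stage k s).labels.map (wt k) : List ℝ)
        = ((virt k s).map (wt k) : Multiset ℝ) + (sigs (s + 1)).map (wt k) := by
      intro s
      rw [← Multiset.map_coe, labels_stage hk, Multiset.map_add, Multiset.map_coe, add_comm]
    have hW : ∀ w ∈ (sigs (s + 1)).map (wt k), ((1 / 2 : ℝ) ^ k) ^ s ≤ w := by
      intro w hw
      obtain ⟨a, ha, rfl⟩ := Multiset.mem_map.mp hw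
      obtain ⟨t, ht, rfl⟩ := mem_sigs ha
      exact pow_le_pow_of_le_one hq0 hq1 (by omega)
    rw [hlab s] at ih
    have h1 := CostBound.of_virt hk s _ _ hW ih
    have h2 := (layer_weights hk (s + 1)).2.2 _ _ (fun w hw =>
      (pow_le_pow_of_le_one hq0 hq1 (by omega)).trans (hW w hw)) h1
    rw [treeCost_stage_succ hk]
    convert h2 using 1
    rw [hlab, ← Multiset.map_coe (wt k) ((layer k (s + 1)).flatMap labels), labels_layer hk, sigs_succ (s + 1), Multiset.map_add,
      Multiset.map_add, Multiset.map_coe]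
    abel

/-! ## The codewords -/

theorem mem_leaves_stage_mono {k s t t' : ℕ} {w : List Bool} (h : t ≤ t')
    (hw : (w, Sym.sig s) ∈ (stage k t).leaves) : (w, Sym.sig s) ∈ (stage k t').leaves := by
  induction t', h using Nat.le_induction with
  | base => exact hw
  | succ t' _ ih =>
    rw [stage, leaves_bind, List.mem_flatMap]
    exact ⟨_, ih, by simp [unfold, leaves]⟩

section

open Classical

theorem count_sigs (s n : ℕ) : (sigs n).count (.sig s) = if s < n then s + 1 else 0 := by
  induction n with
  | zero => simp [sigs_zero]
  | succ n ih =>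
    rw [sigs_succ, Multiset.count_add, ih, Multiset.count_replicate]
    simp only [Sym.sig.injEq]
    split_ifs <;> omega

theorem count_virt (k s t : ℕ) : (virt k s : Multiset Sym).count (.sig t) = 0 := by
  rw [Multiset.count_eq_zero]
  intro h
  simp only [virt, Multiset.mem_coe, List.mem_append, List.mem_replicate, List.mem_singleton] at h
  unfold extra at h
  split_ifs at h <;> simp at h

/-- The leaves of signature `s` in stage `t`. -/
noncomputable def sigLeaves (k s t : ℕ) : Finset (List Bool × Sym) :=
  (stage k t).leaves.toFinset.filter fun p => p.2 = .sig s

theorem card_sigLeaves {k : ℕ} (hk : 1 < k) {s t : ℕ} (h : s ≤ t) :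
    (sigLeaves k s t).card = s + 1 := by
  have h1 : (sigLeaves k s t).card = ((stage k t).leaves.filter fun p => p.2 = .sig s).length := by
    rw [← List.toFinset_card_of_nodup ((nodup_leaves _).filter _), sigLeaves, List.toFinset_filter]
    simp
  have h2 := congrArg (Multiset.count (.sig s)) (labels_stage hk t)
  rw [Multiset.count_add, count_virt, count_sigs, if_pos (by omega), Multiset.coe_count,
    ← map_snd_leaves, List.count, List.countP_map, List.countP_eq_length_filter] at h2
  rw [h1, ← add_zero (s + 1), ← h2]
  congr 1

/-- Leaves of signature s persist, and stage s already has all s + 1 of them, so inclusion together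
with equal cardinality forces equality. -/
theorem sigLeaves_eq {k : ℕ} (hk : 1 < k) {s t t' : ℕ} (h : s ≤ t) (h' : t ≤ t') :
    sigLeaves k s t = sigLeaves k s t' := by
  apply Finset.eq_of_subset_of_card_le
  · rintro ⟨w, a⟩ hp
    simp only [sigLeaves, Finset.mem_filter, List.mem_toFinset] at hp ⊢
    obtain ⟨h1, rfl⟩ := hp
    exact ⟨mem_leaves_stage_mono h' h1, rfl⟩
  · rw [card_sigLeaves hk h, card_sigLeaves hk (h.trans h')]

theorem mem_codewords {k : ℕ} (hk : 1 < k) {s t : ℕ} (h : s ≤ t) (w : List Bool) :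
    w ∈ codewords k s ↔ (w, Sym.sig s) ∈ (stage k t).leaves := by
  refine ⟨?_, fun hw => ⟨t, hw⟩⟩
  rintro ⟨t', hw⟩
  have h1 : (w, Sym.sig s) ∈ sigLeaves k s (max t t') := by
    simp only [sigLeaves, Finset.mem_filter, List.mem_toFinset, and_true]
    exact mem_leaves_stage_mono (le_max_right t t') hw
  rw [← sigLeaves_eq hk h (le_max_left t t')] at h1
  simp only [sigLeaves, Finset.mem_filter, List.mem_toFinset, and_true] at h1
  exact h1

theorem encard_codewords {k : ℕ} (hk : 1 < k) (s : ℕ) : (codewords k s).encard = (s + 1 : ℕ) := by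
  have h1 : codewords k s = Prod.fst '' (sigLeaves k s s : Set (List Bool × Sym)) := by
    ext w
    rw [mem_codewords hk le_rfl]
    simp [sigLeaves]
  rw [h1, Set.InjOn.encard_image, Set.encard_coe_eq_coe_finsetCard, card_sigLeaves hk le_rfl]
  rintro ⟨w, a⟩ h ⟨w', a'⟩ h' he
  simp only [sigLeaves, Finset.coe_filter, Set.mem_ofPred_eq] at h h' he
  rw [he, h.2, h'.2]

end

/-! ### Layered codes: existence, prefix property and fullness -/

theorem setOf_add_eq (s : ℕ) :
    {a : ℕ × ℕ | a.1 + a.2 = s} = (Finset.HasAntidiagonal.antidiagonal s : Set (ℕ × ℕ)) := by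
  ext a
  simp

theorem exists_isLayeredCode {k : ℕ} (hk : 1 < k) : ∃ c, IsLayeredCode k c := by
  have h : ∀ s, ∃ f : ℕ × ℕ → List Bool, Set.BijOn f {a | a.1 + a.2 = s} (codewords k s) := by
    intro s
    apply Set.Finite.exists_bijOn_of_encard_eq
    · rw [setOf_add_eq]
      exact Finset.finite_toSet _
    · rw [encard_codewords hk, setOf_add_eq, Set.encard_coe_eq_coe_finsetCard]
      simp
  choose f hf using h
  refine ⟨fun a => f (a.1 + a.2) a, fun s => (hf s).congr ?_⟩
  intro a ha
  simp only [Set.mem_ofPred_eq] at ha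
  simp [ha]

theorem IsLayeredCode.mem_leaves {k : ℕ} (hk : 1 < k) {c : ℕ × ℕ → List Bool}
    (hc : IsLayeredCode k c) (a : ℕ × ℕ) {t : ℕ} (h : a.1 + a.2 ≤ t) :
    (c a, Sym.sig (a.1 + a.2)) ∈ (stage k t).leaves :=
  (mem_codewords hk h _).mp ((hc (a.1 + a.2)).mapsTo rfl)

theorem IsLayeredCode.injective_leaf {k : ℕ} {c : ℕ × ℕ → List Bool} (hc : IsLayeredCode k c) :
    Function.Injective fun a : ℕ × ℕ => (c a, Sym.sig (a.1 + a.2)) := by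
  intro a b hab
  simp only [Prod.mk.injEq, Sym.sig.injEq] at hab
  exact (hc (b.1 + b.2)).injOn hab.2 rfl hab.1

theorem IsLayeredCode.isPrefixCode {k : ℕ} (hk : 1 < k) {c : ℕ × ℕ → List Bool}
    (hc : IsLayeredCode k c) : IsPrefixCode c := by
  intro a b hab hp
  apply hab
  apply hc.injective_leaf
  exact eq_of_prefix_of_mem_leaves (stage k (max (a.1 + a.2) (b.1 + b.2)))
    (hc.mem_leaves hk a (le_max_left _ _)) (hc.mem_leaves hk b (le_max_right _ _)) hp

/-- The unfolding of every symbol contains a leaf of the code. -/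
theorem exists_sig_unfold {k : ℕ} (hk : 1 < k) (v : Sym) :
    ∃ t, Sym.sig t ∈ (unfold k v).labels := by
  obtain ⟨h3, h4⟩ := two_pow_facts hk
  simp only [labels_unfold hk, List.mem_flatMap]
  have hone : ∀ s, Sym.sig s ∈ (one s).labels := fun s => by simp [one, labels]
  have hpair : ∀ s, Sym.sig s ∈ (pair s).labels := fun s => by simp [pair, one, labels]
  have hnode : ∀ s, Sym.sig s ∈ (node (root s) (one s)).labels := fun s => by
    simp [root, one, labels]
  rcases v with s | ⟨m, s⟩ | s | s | s
  · exact ⟨s, one s, by simp [sub], hone s⟩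
  · exact ⟨s, one s, by simp [sub], hone s⟩
  · exact ⟨s, one s, by simp [sub]; omega, hone s⟩
  · exact ⟨s, one s, by simp [sub]; omega, hone s⟩
  · refine ⟨s + 1, ?_⟩
    simp only [sub, rootList]
    split_ifs
    · exact ⟨_, by simp, hnode _⟩
    · exact ⟨_, by simp, hnode _⟩
    · exact ⟨pair (s + 1), by simp; omega, hpair _⟩
    · exact ⟨one (s + 1), by simp; omega, hone _⟩
    · exact ⟨one (s + 1), by simp, hone _⟩
    · exact ⟨_, by simp, hnode _⟩

theorem IsLayeredCode.isFull {k : ℕ} (hk : 1 < k) {c : ℕ × ℕ → List Bool}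
    (hc : IsLayeredCode k c) : IsFull c := by
  intro w a hw hne b
  obtain ⟨⟨w', v⟩, hp, hw'⟩ := exists_leaf_extending _ (hc.mem_leaves hk a le_rfl) hw hne b
  obtain ⟨t, ht⟩ := exists_sig_unfold hk v
  -- The leaf found below the child may be virtual; one more unfolding continues its word to a
  -- genuine codeword.
  rw [← map_snd_leaves, List.mem_map] at ht
  obtain ⟨⟨u, v'⟩, hu, rfl⟩ := ht
  have hmem : w' ++ u ∈ codewords k t := by
    refine ⟨a.1 + a.2 + 1, ?_⟩
    rw [stage, leaves_bind, List.mem_flatMap]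
    exact ⟨_, hp, List.mem_map.mpr ⟨_, hu, rfl⟩⟩
  obtain ⟨a', _, ha'⟩ := (hc t).surjOn hmem
  exact ⟨a', ha' ▸ hw'.trans (List.prefix_append w' u)⟩

/-! ## Optimality -/

/-- The pairs of signature less than `s`. -/
def below (s : ℕ) : Finset (ℕ × ℕ) := (Finset.range s).biUnion Finset.HasAntidiagonal.antidiagonal

theorem mem_below {s : ℕ} {a : ℕ × ℕ} : a ∈ below s ↔ a.1 + a.2 < s := by
  simp [below]

theorem disjoint_below (s : ℕ) : Disjoint (below s) (Finset.HasAntidiagonal.antidiagonal s) := by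
  rw [Finset.disjoint_left]
  intro a h h'
  rw [mem_below] at h
  rw [Finset.HasAntidiagonal.mem_antidiagonal] at h'
  omega

theorem below_succ (s : ℕ) : below (s + 1) = (below s).disjUnion _ (disjoint_below s) := by
  ext a
  simp only [Finset.mem_disjUnion, mem_below, Finset.HasAntidiagonal.mem_antidiagonal]
  omega

theorem sum_below_succ (s : ℕ) (f : ℕ × ℕ → ℝ) :
    ∑ a ∈ below (s + 1), f a = ∑ a ∈ below s, f a + ∑ a ∈ Finset.HasAntidiagonal.antidiagonal s, f a := by
  rw [below_succ, Finset.sum_disjUnion]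

theorem map_below (s : ℕ) : (below s).val.map (fun a => Sym.sig (a.1 + a.2)) = sigs s := by
  induction s with
  | zero => rfl
  | succ s ih =>
    rw [below_succ, Finset.disjUnion_val, Multiset.map_add, ih, sigs_succ]
    congr 1
    rw [Multiset.eq_replicate]
    constructor
    · simp
    · intro b hb
      obtain ⟨a, ha, rfl⟩ := Multiset.mem_map.mp hb
      rw [Finset.mem_val, Finset.HasAntidiagonal.mem_antidiagonal] at ha
      rw [ha]

theorem tendsto_below : Filter.Tendsto below Filter.atTop Filter.atTop := by
  apply Filter.tendsto_atTop_finset_of_monotone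
  · intro s t hst a ha
    rw [mem_below] at *
    omega
  · intro a
    exact ⟨a.1 + a.2 + 1, mem_below.mpr (by omega)⟩

/-- A prefix code costs at least as much as a stage, up to the symbols that are used in place of
the virtual symbols. -/
theorem treeCost_stage_le {k : ℕ} (hk : 1 < k) {c : ℕ × ℕ → List Bool} (hc : IsPrefixCode c)
    (s : ℕ) :
    treeCost (wt k) (stage k s) ≤
      ∑ a ∈ below (s + 1), ((1 / 2 : ℝ) ^ k) ^ (a.1 + a.2) * (c a).length +
      ((1 / 2 : ℝ) ^ k) ^ s * ∑ a ∈ Finset.HasAntidiagonal.antidiagonal (s + 1), ((c a).length : ℝ) := by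
  -- The codewords of `U` supply lengths for the virtual symbols. Since `U` is disjoint from the
  -- pairs of signature at most s, Kraft's inequality holds for the whole assignment.
  obtain ⟨U, hU, hUc⟩ := Finset.exists_subset_card_eq
    (show (virt k s).length ≤ (Finset.HasAntidiagonal.antidiagonal (s + 1)).card by simpa using length_virt_le hk s)
  have hdisj : Disjoint (below (s + 1)) U := (disjoint_below (s + 1)).mono_right hU
  have hlen : ((virt k s).map (wt k)).length = (U.toList.map fun a => (c a).length).length := by
    simp [hUc]
  have h := costBound_stage hk s
    ((below (s + 1)).val.map (fun a => (((1 / 2 : ℝ) ^ k) ^ (a.1 + a.2), (c a).length)) +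
      (((virt k s).map (wt k)).zip (U.toList.map fun a => (c a).length) : List (ℝ × ℕ)))
    (by
      rw [Multiset.map_add, Multiset.map_map, Multiset.map_coe, List.map_fst_zip hlen.le,
        ← Multiset.map_coe, ← Multiset.map_coe, labels_stage hk, Multiset.map_add, ← map_below,
        Multiset.map_map]
      rfl)
    (by
      rw [Multiset.map_add, Multiset.map_map, Multiset.map_coe, List.map_snd_zip hlen.ge]
      have := hc.kraft ((below (s + 1)).disjUnion U hdisj)
      rw [Finset.sum_disjUnion, ← Finset.sum_map_toList U] at this
      rw [kraftSum, Multiset.map_add, Multiset.sum_add, Multiset.map_map, Multiset.map_coe,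
        List.map_map, Multiset.sum_coe]
      exact this)
  refine h.trans ?_
  rw [cost, Multiset.map_add, Multiset.sum_add, Multiset.map_map, Multiset.map_coe,
    Multiset.sum_coe]
  refine add_le_add (le_of_eq rfl) ?_
  have hq : (0 : ℝ) ≤ ((1 / 2 : ℝ) ^ k) ^ s := by positivity
  calc _ ≤ ((((virt k s).map (wt k)).zip (U.toList.map fun a => (c a).length)).map
        fun p => ((1 / 2 : ℝ) ^ k) ^ s * (p.2 : ℝ)).sum := by
        apply List.sum_le_sum
        rintro ⟨w, l⟩ hp
        obtain ⟨v, hv, rfl⟩ := List.mem_map.mp (List.of_mem_zip hp).1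
        exact mul_le_mul_of_nonneg_right (wt_virt_le hk hv) (by positivity)
    _ = ((1 / 2 : ℝ) ^ k) ^ s * ∑ a ∈ U, ((c a).length : ℝ) := by
        rw [List.sum_map_mul_left, ← Finset.sum_map_toList U]
        congr 2
        have := List.map_snd_zip hlen.ge
        rw [← Function.comp_def (fun n : ℕ => (n : ℝ)) Prod.snd, ← List.map_map, this, List.map_map]
        rfl
    _ ≤ _ := mul_le_mul_of_nonneg_left
        (Finset.sum_le_sum_of_subset_of_nonneg hU fun _ _ _ => by positivity) hq

/-- The codewords of signature at most s are paths to leaves of the stage; dropping the virtual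
leaves removes only nonnegative terms. -/
theorem IsLayeredCode.sum_below_le {k : ℕ} (hk : 1 < k) {c : ℕ × ℕ → List Bool}
    (hc : IsLayeredCode k c) (s : ℕ) :
    ∑ a ∈ below (s + 1), ((1 / 2 : ℝ) ^ k) ^ (a.1 + a.2) * (c a).length
      ≤ treeCost (wt k) (stage k s) := by
  classical
  rw [treeCost, ← List.sum_toFinset _ (nodup_leaves _)]
  have h := Finset.sum_image (s := below (s + 1)) (g := fun a => (c a, Sym.sig (a.1 + a.2)))
    (f := fun p => wt k p.2 * (p.1.length : ℝ)) (fun a _ b _ hab => hc.injective_leaf hab)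
  refine le_trans (le_of_eq h.symm) ?_
  apply Finset.sum_le_sum_of_subset_of_nonneg
  · intro p hp
    obtain ⟨a, ha, rfl⟩ := Finset.mem_image.mp hp
    rw [List.mem_toFinset]
    exact hc.mem_leaves hk a (Nat.lt_succ_iff.mp (mem_below.mp ha))
  · intro p _ _
    exact mul_nonneg (wt_nonneg hk _) (by positivity)

theorem prob_nonneg {q : ℝ} (hq : 0 ≤ q) (a : ℕ × ℕ) : 0 ≤ prob q a := by
  unfold prob
  positivity

theorem avgLength_eq {q : ℝ} (hq : 0 ≤ q) (c : ℕ × ℕ → List Bool) :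
    avgLength q c = ∑' a, ENNReal.ofReal (prob q a * (c a).length) := by
  unfold avgLength
  congr 1
  ext a
  rw [ENNReal.ofReal_mul (prob_nonneg hq a), ENNReal.ofReal_natCast]

theorem avgLength_ne_top_iff {q : ℝ} (hq : 0 ≤ q) (c : ℕ × ℕ → List Bool) :
    avgLength q c ≠ ⊤ ↔ Summable fun a => prob q a * ((c a).length : ℝ) := by
  have h0 : ∀ a, 0 ≤ prob q a * ((c a).length : ℝ) := fun a =>
    mul_nonneg (prob_nonneg hq a) (by positivity)
  rw [avgLength_eq hq]
  constructor
  · intro h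
    refine (ENNReal.summable_toReal h).congr fun a => ?_
    exact ENNReal.toReal_ofReal (h0 a)
  · intro h
    rw [← ENNReal.ofReal_tsum_of_nonneg h0 h]
    exact ENNReal.ofReal_ne_top

theorem IsLayeredCode.avgLength_le {k : ℕ} (hk : 1 < k) {c c' : ℕ × ℕ → List Bool}
    (hc : IsLayeredCode k c) (hc' : IsPrefixCode c') :
    avgLength ((1 / 2 : ℝ) ^ k) c ≤ avgLength ((1 / 2 : ℝ) ^ k) c' := by
  have hq : (0 : ℝ) ≤ (1 / 2 : ℝ) ^ k := by positivity
  have hinv := two_pow_mul_half k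
  by_cases htop : avgLength ((1 / 2 : ℝ) ^ k) c' = ⊤
  · rw [htop]; exact le_top
  have hsum := (avgLength_ne_top_iff hq c').mp htop
  set q := (1 / 2 : ℝ) ^ k
  have h0 : ∀ (c : ℕ × ℕ → List Bool) a, 0 ≤ prob q a * ((c a).length : ℝ) := fun c a =>
    mul_nonneg (prob_nonneg hq a) (by positivity)
  have step : ∀ s, ∑ a ∈ below (s + 1), prob q a * ((c a).length : ℝ) ≤
      ∑ a ∈ below (s + 1), prob q a * ((c' a).length : ℝ) +
      2 ^ k * (∑ a ∈ below (s + 2), prob q a * ((c' a).length : ℝ) -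
        ∑ a ∈ below (s + 1), prob q a * ((c' a).length : ℝ)) := by
    intro s
    have h1 := mul_le_mul_of_nonneg_left ((hc.sum_below_le hk s).trans (treeCost_stage_le hk hc' s))
      (sq_nonneg (1 - q))
    -- As q^s = 2^k q^(s+1), the error is a fixed multiple of the next block of the series of `c'`,
    -- hence tends to 0.
    have h2 : 2 ^ k * ∑ a ∈ Finset.HasAntidiagonal.antidiagonal (s + 1), prob q a * ((c' a).length : ℝ)
        = (1 - q) ^ 2 * (q ^ s * ∑ a ∈ Finset.HasAntidiagonal.antidiagonal (s + 1), ((c' a).length : ℝ)) := by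
      rw [Finset.mul_sum, Finset.mul_sum, Finset.mul_sum]
      apply Finset.sum_congr rfl
      intro a ha
      rw [Finset.HasAntidiagonal.mem_antidiagonal] at ha
      rw [prob, ha, ← hinv s]
      ring
    have h3 : ∀ c : ℕ × ℕ → List Bool, ∑ a ∈ below (s + 1), prob q a * ((c a).length : ℝ)
        = (1 - q) ^ 2 * ∑ a ∈ below (s + 1), q ^ (a.1 + a.2) * ((c a).length : ℝ) := by
      intro c
      rw [Finset.mul_sum]
      apply Finset.sum_congr rfl
      intro a _
      rw [prob]
      ring
    rw [sum_below_succ (s + 1), add_sub_cancel_left, h2, h3, h3, ← mul_add]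
    exact h1
  have hlim : ∀ n, Filter.Tendsto
      (fun s => ∑ a ∈ below (s + n), prob q a * ((c' a).length : ℝ)) Filter.atTop
      (nhds (∑' a, prob q a * ((c' a).length : ℝ))) := fun n =>
    (hsum.hasSum.comp tendsto_below).comp (Filter.tendsto_add_atTop_nat n)
  have hlim' := (hlim 1).add (((hlim 2).sub (hlim 1)).const_mul (2 ^ k : ℝ))
  rw [sub_self, mul_zero, add_zero] at hlim'
  have hbound : ∀ S : Finset (ℕ × ℕ), ∑ a ∈ S, prob q a * ((c a).length : ℝ)
      ≤ ∑' a, prob q a * ((c' a).length : ℝ) := by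
    intro S
    apply ge_of_tendsto hlim'
    have hS : ∀ᶠ s in Filter.atTop, S ≤ below (s + 1) :=
      (tendsto_below.comp (Filter.tendsto_add_atTop_nat 1)).eventually (Filter.eventually_ge_atTop S)
    filter_upwards [hS] with s hs
    exact (Finset.sum_le_sum_of_subset_of_nonneg hs fun a _ _ => h0 c a).trans (step s)
  have hsc := summable_of_sum_le (h0 c) hbound
  rw [avgLength_eq hq, avgLength_eq hq, ← ENNReal.ofReal_tsum_of_nonneg (h0 c) hsc,
    ← ENNReal.ofReal_tsum_of_nonneg (h0 c') hsum]
  exact ENNReal.ofReal_le_ofReal (hsc.tsum_le_of_sum_le hbound)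

/-! ## A code of finite average length -/

/-- Both components in unary. -/
def unaryCode (a : ℕ × ℕ) : List Bool :=
  List.replicate a.1 true ++ false :: (List.replicate a.2 true ++ [false])

theorem replicate_true_prefix {i j : ℕ} {u v : List Bool}
    (h : List.replicate i true ++ false :: u <+: List.replicate j true ++ false :: v) :
    i = j ∧ u <+: v := by
  induction i generalizing j with
  | zero =>
    cases j with
    | zero => simpa using h
    | succ j => simp [List.replicate_succ] at h
  | succ i ih =>
    cases j with
    | zero => simp [List.replicate_succ] at h
    | succ j =>
      simp only [List.replicate_succ, List.cons_append, List.cons_prefix_cons, true_and] at h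
      obtain ⟨h1, h2⟩ := ih h
      exact ⟨by rw [h1], h2⟩

theorem isPrefixCode_unaryCode : IsPrefixCode unaryCode := by
  intro a b hab h
  obtain ⟨h1, h2⟩ := replicate_true_prefix h
  obtain ⟨h3, _⟩ := replicate_true_prefix h2
  exact hab (Prod.ext h1 h3)

/-- The length (i + 1) + (j + 1) splits the series into two products of convergent one-variable
series. -/
theorem avgLength_unaryCode {q : ℝ} (hq : 0 ≤ q) (hq1 : q < 1) : avgLength q unaryCode ≠ ⊤ := by
  rw [avgLength_ne_top_iff hq]
  have hn : ‖q‖ < 1 := by rwa [Real.norm_of_nonneg hq]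
  have h1 : Summable fun n : ℕ => ((n : ℝ) + 1) * q ^ n := by
    have := (summable_pow_mul_geometric_of_norm_lt_one 1 hn).add
      (summable_geometric_of_norm_lt_one hn)
    refine this.congr fun n => ?_
    ring
  have h2 : Summable fun n : ℕ => q ^ n := summable_geometric_of_norm_lt_one hn
  have h3 := (h1.mul_of_nonneg h2 (fun n => by positivity) (fun n => by positivity)).add
    (h2.mul_of_nonneg h1 (fun n => by positivity) (fun n => by positivity))
  refine (h3.mul_left ((1 - q) ^ 2)).congr fun a => ?_
  simp only [prob, unaryCode, List.length_append, List.length_replicate, List.length_cons,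
    List.length_nil]
  push_cast
  ring

end TDGD

theorem theorem6 (k : ℕ) (hk : 1 < k) :
    (∀ s, ∃ d, (TDGD.stage k s).level d = TDGD.layer k s) ∧
    (∃ c, TDGD.IsLayeredCode k c) ∧
    ∀ c : ℕ × ℕ → List Bool, TDGD.IsLayeredCode k c →
      TDGD.IsFull c ∧
      TDGD.IsOptimal ((1 / 2 : ℝ) ^ k) c ∧
      TDGD.avgLength ((1 / 2 : ℝ) ^ k) c ≠ ⊤ := by
  refine ⟨fun s => ?_, TDGD.exists_isLayeredCode hk, fun c hc => ⟨hc.isFull hk,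
    ⟨hc.isPrefixCode hk, fun c' hc' => hc.avgLength_le hk hc'⟩, ?_⟩⟩
  · obtain ⟨d, _, hd⟩ := TDGD.exists_level_stage hk s
    exact ⟨d, hd⟩
  · exact ne_top_of_le_ne_top
      (TDGD.avgLength_unaryCode (by positivity) (pow_lt_one₀ (by norm_num) (by norm_num) (by omega)))
      (hc.avgLength_le hk TDGD.isPrefixCode_unaryCode)
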